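/- Graphs are finite, undirected and simple, $\mathrm{Aut}(X)$ is the automorphism group of a graph $X$, and $G'$ is the commutator subgroup of a group $G$. A group $G$ is *representable* on a graph $X$ if there is a homomorphism $G \to \mathrm{Aut}(X)$ that does not map all elements of $G$ to the identity. The *solvable group representability problem* is: given a finite solvable group $G$, by its multiplication table, and a graph $X$, by its adjacency matrix, decide whether $G$ is representable on $X$. The *graph isomorphism problem* is: given two graphs, by their adjacency matrices, decide whether they are isomorphic. **Theorem.** The solvable group representability problem is polynomial-time Turing reducible to the graph isomorphism problem: there are an oracle algorithm (a program of a unit-cost random access machine with addition and subtraction, on which a query costs in addition the bit length of the queried word) and a polynomial $p$ such that, with every oracle that correctly answers all instances of graph isomorphism, the algorithm correctly decides every instance of the solvable group representability problem in at most $p(s)$ steps, where $s$ is the bit length of the instance. Moreover, a finite solvable group $G$ is representable on a graph $X$ if and only if $\#(G/G')$ and $\#\mathrm{Aut}(X)$ have a common prime factor. -/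

import Mathlib

/-- Words over the natural numbers: the inputs of machines and the queries to oracles. -/
abbrev Word : Type := List ℕ

/-- The bit length of a word; every letter also counts one for a separator. -/
def wordSize (w : Word) : ℕ := (w.map fun a => Nat.size a + 1).sum

/-! ### Oracle random access machines

The unit-cost RAM with addition and truncated subtraction as its only arithmetic operations and
with indirect addressing. Control is structured. A program is a finite term, so it mentions only
finitely many registers and memory banks. -/

namespace OracleRAM

/-- A machine state: the registers, and the memory banks with their cells `mem a i`. -/
structure State where
  reg : ℕ → ℕ
  mem : ℕ → ℕ → ℕ

/-- Assign a value to a register. -/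
def State.setReg (s : State) (x v : ℕ) : State :=
  { s with reg := Function.update s.reg x v }

/-- Assign a value to the cell `i` of the memory bank `a`. -/
def State.setMem (s : State) (a i v : ℕ) : State :=
  { s with mem := Function.update s.mem a (Function.update (s.mem a) i v) }

/-- The word in the first `k` cells of the memory bank `a`. -/
def State.word (s : State) (a k : ℕ) : Word := (List.range k).map (s.mem a)

/-- Programs. Here `x`, `y`, `z` are names of registers, `a` is the name of a memory bank. -/
inductive Prog : Type
  /-- do nothing -/
  | skip
  /-- `x := c` -/
  | const (x c : ℕ)
  /-- `x := y + z` -/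
  | add (x y z : ℕ)
  /-- `x := y - z`, truncated at zero -/
  | sub (x y z : ℕ)
  /-- `x := a[y]` -/
  | load (x a y : ℕ)
  /-- `a[x] := y` -/
  | store (a x y : ℕ)
  /-- `x := 1` if the oracle contains the word `a[0], …, a[y - 1]`, and `x := 0` otherwise -/
  | query (x a y : ℕ)
  /-- first `P`, then `Q` -/
  | seq (P Q : Prog)
  /-- `P` if `x ≠ 0`, and `Q` otherwise -/
  | ite (x : ℕ) (P Q : Prog)
  /-- repeat `P` as long as `x ≠ 0` -/
  | loop (x : ℕ) (P : Prog)

/-- `Exec O P s t s'`: with the oracle `O`, the program `P` started in the state `s` halts in the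
state `s'` after exactly `t` steps. Every assignment and every test is one step; a query costs in
addition the bit length of the word that is submitted. -/
inductive Exec (O : Set Word) : Prog → State → ℕ → State → Prop
  | skip (s : State) : Exec O .skip s 1 s
  | const (s : State) (x c : ℕ) : Exec O (.const x c) s 1 (s.setReg x c)
  | add (s : State) (x y z : ℕ) : Exec O (.add x y z) s 1 (s.setReg x (s.reg y + s.reg z))
  | sub (s : State) (x y z : ℕ) : Exec O (.sub x y z) s 1 (s.setReg x (s.reg y - s.reg z))
  | load (s : State) (x a y : ℕ) : Exec O (.load x a y) s 1 (s.setReg x (s.mem a (s.reg y)))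
  | store (s : State) (a x y : ℕ) : Exec O (.store a x y) s 1 (s.setMem a (s.reg x) (s.reg y))
  | query_yes (s : State) (x a y : ℕ) (h : s.word a (s.reg y) ∈ O) :
      Exec O (.query x a y) s (1 + wordSize (s.word a (s.reg y))) (s.setReg x 1)
  | query_no (s : State) (x a y : ℕ) (h : s.word a (s.reg y) ∉ O) :
      Exec O (.query x a y) s (1 + wordSize (s.word a (s.reg y))) (s.setReg x 0)
  | seq {P Q : Prog} {s s₁ s₂ : State} {t₁ t₂ : ℕ} (h₁ : Exec O P s t₁ s₁)
      (h₂ : Exec O Q s₁ t₂ s₂) : Exec O (.seq P Q) s (t₁ + t₂) s₂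
  | ite_true {x : ℕ} {P Q : Prog} {s s' : State} {t : ℕ} (hx : s.reg x ≠ 0)
      (h : Exec O P s t s') : Exec O (.ite x P Q) s (1 + t) s'
  | ite_false {x : ℕ} {P Q : Prog} {s s' : State} {t : ℕ} (hx : s.reg x = 0)
      (h : Exec O Q s t s') : Exec O (.ite x P Q) s (1 + t) s'
  | loop_done {x : ℕ} {P : Prog} {s : State} (hx : s.reg x = 0) : Exec O (.loop x P) s 1 s
  | loop_step {x : ℕ} {P : Prog} {s s₁ s₂ : State} {t₁ t₂ : ℕ} (hx : s.reg x ≠ 0)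
      (h₁ : Exec O P s t₁ s₁) (h₂ : Exec O (.loop x P) s₁ t₂ s₂) :
      Exec O (.loop x P) s (1 + t₁ + t₂) s₂

/-- The machine is deterministic: running time and final state are determined by the program, the
oracle and the initial state. -/
theorem Exec.unique {O : Set Word} {P : Prog} {s s₁ s₂ : State} {t₁ t₂ : ℕ}
    (h₁ : Exec O P s t₁ s₁) (h₂ : Exec O P s t₂ s₂) : t₁ = t₂ ∧ s₁ = s₂ := by
  induction h₁ generalizing t₂ s₂ with
  | skip | const | add | sub | load | store => cases h₂; exact ⟨rfl, rfl⟩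
  | query_yes s x a y h => cases h₂ with
    | query_yes => exact ⟨rfl, rfl⟩
    | query_no _ _ _ _ h' => exact absurd h h'
  | query_no s x a y h => cases h₂ with
    | query_yes _ _ _ _ h' => exact absurd h' h
    | query_no => exact ⟨rfl, rfl⟩
  | seq _ _ ih₁ ih₂ => cases h₂ with
    | seq k₁ k₂ =>
      obtain ⟨rfl, rfl⟩ := ih₁ k₁
      obtain ⟨rfl, rfl⟩ := ih₂ k₂
      exact ⟨rfl, rfl⟩
  | ite_true hx _ ih => cases h₂ with
    | ite_true _ k => obtain ⟨rfl, rfl⟩ := ih k; exact ⟨rfl, rfl⟩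
    | ite_false hx' _ => exact absurd hx' hx
  | ite_false hx _ ih => cases h₂ with
    | ite_true hx' _ => exact absurd hx hx'
    | ite_false _ k => obtain ⟨rfl, rfl⟩ := ih k; exact ⟨rfl, rfl⟩
  | loop_done hx => cases h₂ with
    | loop_done => exact ⟨rfl, rfl⟩
    | loop_step hx' _ _ => exact absurd hx hx'
  | loop_step hx _ _ ih₁ ih₂ => cases h₂ with
    | loop_done hx' => exact absurd hx' hx
    | loop_step _ k₁ k₂ =>
      obtain ⟨rfl, rfl⟩ := ih₁ k₁
      obtain ⟨rfl, rfl⟩ := ih₂ k₂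
      exact ⟨rfl, rfl⟩

/-- The initial state on the input `w`: its length is in register `0`, its letters are in the
memory bank `0`, and everything else is zero. -/
def init (w : Word) : State where
  reg := fun x => if x = 0 then w.length else 0
  mem := fun a i => if a = 0 then w.getD i 0 else 0

end OracleRAM

/-! ### Decision problems and reductions -/

/-- A decision problem: the words that encode instances, and among them the words that encode
instances with the answer yes. -/
structure DecisionProblem where
  instances : Set Word
  yes : Set Word
  yes_subset : yes ⊆ instances

/-- `A` is polynomial-time Turing reducible to `B`: one oracle program decides `A`, within a number
of steps that is polynomial in the bit length of the input, with every oracle that answers all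
instances of `B` correctly. The answer is yes if register `0` is nonzero on halting. -/
def PolyTimeTuringReducible (A B : DecisionProblem) : Prop :=
  ∃ (P : OracleRAM.Prog) (p : Polynomial ℕ),
    ∀ O : Set Word, (∀ q ∈ B.instances, q ∈ O ↔ q ∈ B.yes) →
      ∀ w ∈ A.instances, ∃ (t : ℕ) (s : OracleRAM.State),
        OracleRAM.Exec O P (OracleRAM.init w) t s ∧ t ≤ p.eval (wordSize w) ∧
          (s.reg 0 ≠ 0 ↔ w ∈ A.yes)

/-! ### Groups and graphs as inputs -/

/-- The multiplication table, row by row, of a finite group whose elements are numbered by `e`. -/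
def tableWord {G : Type} [Group G] {m : ℕ} (e : Fin m ≃ G) : Word :=
  (List.finRange m).flatMap fun i => (List.finRange m).map fun j => (e.symm (e i * e j) : ℕ)

open Classical in
/-- The adjacency matrix, row by row, of a graph with the vertices `0, …, n - 1`. -/
noncomputable def adjWord {n : ℕ} (X : SimpleGraph (Fin n)) : Word :=
  (List.finRange n).flatMap fun i => (List.finRange n).map fun j => if X.Adj i j then 1 else 0

/-- The order of the group, the number of vertices, the multiplication table, the adjacency
matrix. -/
noncomputable def groupGraphWord {G : Type} [Group G] {m n : ℕ} (e : Fin m ≃ G)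
    (X : SimpleGraph (Fin n)) : Word :=
  m :: n :: (tableWord e ++ adjWord X)

/-- The two numbers of vertices, and the two adjacency matrices. -/
noncomputable def graphPairWord {n k : ℕ} (X : SimpleGraph (Fin n)) (Y : SimpleGraph (Fin k)) :
    Word :=
  n :: k :: (adjWord X ++ adjWord Y)

/-- `G` is representable on `X`: there is a homomorphism from `G` to the automorphism group of `X`
that does not map all elements to the identity. -/
def Representable (G : Type*) [Group G] {V : Type*} (X : SimpleGraph V) : Prop :=
  ∃ ρ : G →* (X ≃g X), ∃ g : G, ρ g ≠ 1

/-- Given a finite solvable group by its multiplication table and a finite graph, decide whether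
the group is representable on the graph. -/
def solvableRepresentability : DecisionProblem where
  instances := {w | ∃ (G : Type) (_ : Group G) (m n : ℕ) (e : Fin m ≃ G) (X : SimpleGraph (Fin n)),
    Group.IsSolvable G ∧ w = groupGraphWord e X}
  yes := {w | ∃ (G : Type) (_ : Group G) (m n : ℕ) (e : Fin m ≃ G) (X : SimpleGraph (Fin n)),
    Group.IsSolvable G ∧ w = groupGraphWord e X ∧ Representable G X}
  yes_subset := by
    rintro w ⟨G, i, m, n, e, X, hG, hw, -⟩
    exact ⟨G, i, m, n, e, X, hG, hw⟩

/-- Given two finite graphs, decide whether they are isomorphic. -/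
def graphIsomorphism : DecisionProblem where
  instances := {w | ∃ (n k : ℕ) (X : SimpleGraph (Fin n)) (Y : SimpleGraph (Fin k)),
    w = graphPairWord X Y}
  yes := {w | ∃ (n k : ℕ) (X : SimpleGraph (Fin n)) (Y : SimpleGraph (Fin k)),
    w = graphPairWord X Y ∧ Nonempty (X ≃g Y)}
  yes_subset := by
    rintro w ⟨n, k, X, Y, hw, -⟩
    exact ⟨n, k, X, Y, hw⟩

/-! A nontrivial homomorphism from a solvable group `G` has a nontrivial solvable image, whose
abelianization is again nontrivial and is a quotient of `G / G'`; so a prime that divides the order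
of the latter divides the order of `Aut X`. Conversely, for a common prime factor `p` the abelian
group `G / G'` maps onto a cyclic group of order `p`, and `Aut X` contains one by Cauchy's theorem.

Hence `G` is representable on `X` if and only if `x ^ |Aut X| ∈ G'` for some `x ∉ G'`, and this can
be decided in polynomial time with an oracle for graph isomorphism. The order of `Aut X` is the
product, over the vertices `i`, of the lengths of the orbits of `i` under the automorphisms that fix
all smaller vertices. Whether `j` lies in the orbit of `i` is an instance of graph isomorphism: in
two copies of `X`, mark the smaller vertices and `i` respectively `j` by different numbers of
pendant vertices. The order itself may be exponentially large, but the powers `x ^ |Aut X|` can be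
computed in `G` one orbit at a time. The elements of `G'` are found by closing the set of
commutators under multiplication.

The algorithm is written in a language of bounded loops whose commands compile to programs of the
machine; bounds on the running times are computed along with the compilation.
-/

section Groups

theorem exists_monoidHom_ne_one_of_prime_dvd_card {A H : Type*} [CommGroup A] [Finite A] [Group H]
    [Finite H] {p : ℕ} (hp : p.Prime) (hA : p ∣ Nat.card A) (hH : p ∣ Nat.card H) :
    ∃ φ : A →* H, φ ≠ 1 := by
  -- Cauchy's theorem in the dual group of `A` gives a character of order `p`. Its values are `p`-th
  -- roots of unity, which form a cyclic group of order `p`, like some subgroup of `H`.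
  have : Fact p.Prime := ⟨hp⟩
  have : NeZero (Monoid.exponent A) := ⟨Monoid.exponent_ne_zero_of_finite⟩
  obtain ⟨dual⟩ := CommGroup.monoidHom_mulEquiv_of_hasEnoughRootsOfUnity A ℂ
  have : Finite (A →* ℂˣ) := Finite.of_equiv A dual.symm
  obtain ⟨χ, hχ⟩ := exists_prime_orderOf_dvd_card' p
    (hA.trans (Nat.card_congr dual.toEquiv).symm.dvd)
  obtain ⟨x, hx⟩ := exists_prime_orderOf_dvd_card' p hH
  have hχp (a : A) : χ a ∈ rootsOfUnity p ℂ := by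
    rw [mem_rootsOfUnity, ← MonoidHom.pow_apply, ← hχ, pow_orderOf_eq_one, MonoidHom.one_apply]
  let e : rootsOfUnity p ℂ ≃* Subgroup.zpowers x :=
    mulEquivOfPrimeCardEq (Complex.card_rootsOfUnity p) (by rw [Nat.card_zpowers, hx])
  refine ⟨(Subgroup.zpowers x).subtype.comp (e.toMonoidHom.comp (χ.codRestrict _ hχp)), ?_⟩
  intro h
  have hχ1 : χ = 1 := MonoidHom.ext fun a => by
    have ha : e ⟨χ a, hχp a⟩ = 1 := Subtype.ext (DFunLike.congr_fun h a)
    exact congrArg Subtype.val (e.map_eq_one_iff.1 ha)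
  exact hp.one_lt.ne (by rw [← hχ, hχ1, orderOf_one])

variable {G H : Type*} [Group G] [Group H]

theorem exists_common_prime_of_monoidHom_ne_one [Group.IsSolvable G] {ρ : G →* H} (hρ : ρ ≠ 1) :
    ∃ p : ℕ, p.Prime ∧ p ∣ Nat.card (G ⧸ commutator G) ∧ p ∣ Nat.card H := by
  have : Nontrivial ρ.range := by
    rwa [Subgroup.nontrivial_iff_ne_bot, Ne, MonoidHom.range_eq_bot_iff]
  have : Group.IsSolvable ρ.range := Group.isSolvable_of_surjective ρ.rangeRestrict_surjective
  have hindex : (commutator ρ.range).index ≠ 1 :=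
    mt Subgroup.index_eq_one.1 (Group.IsSolvable.commutator_lt_top_of_nontrivial ρ.range).ne
  have hsurj : Function.Surjective (Abelianization.map ρ.rangeRestrict) :=
    .of_comp (g := Abelianization.of)
      (QuotientGroup.mk_surjective.comp ρ.rangeRestrict_surjective :)
  exact ⟨_, Nat.minFac_prime hindex,
    (Nat.minFac_dvd _).trans (Subgroup.card_dvd_of_surjective _ hsurj),
    ((Nat.minFac_dvd _).trans (Subgroup.index_dvd_card _)).trans ρ.range.card_subgroup_dvd_card⟩

theorem exists_monoidHom_ne_one_iff [Group.IsSolvable G] [Finite (G ⧸ commutator G)] [Finite H] :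
    (∃ ρ : G →* H, ρ ≠ 1) ↔
      ∃ p : ℕ, p.Prime ∧ p ∣ Nat.card (G ⧸ commutator G) ∧ p ∣ Nat.card H := by
  refine ⟨fun ⟨_, hρ⟩ => exists_common_prime_of_monoidHom_ne_one hρ, fun ⟨p, hp, hG, hH⟩ => ?_⟩
  have : Finite (Abelianization G) := ‹Finite (G ⧸ commutator G)›
  obtain ⟨φ, hφ⟩ := exists_monoidHom_ne_one_of_prime_dvd_card (A := Abelianization G) hp hG hH
  exact ⟨φ.comp Abelianization.of, fun h => hφ (Abelianization.hom_ext _ _ h)⟩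

theorem exists_ne_one_pow_eq_one_iff [Finite G] (N : ℕ) :
    (∃ a : G, a ≠ 1 ∧ a ^ N = 1) ↔ ∃ p : ℕ, p.Prime ∧ p ∣ Nat.card G ∧ p ∣ N := by
  constructor
  · rintro ⟨a, ha, haN⟩
    have hd := Nat.minFac_dvd (orderOf a)
    exact ⟨_, Nat.minFac_prime (mt orderOf_eq_one_iff.1 ha), hd.trans (orderOf_dvd_natCard a),
      hd.trans (orderOf_dvd_of_pow_eq_one haN)⟩
  · rintro ⟨p, hp, hG, hN⟩
    have : Fact p.Prime := ⟨hp⟩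
    obtain ⟨a, ha⟩ := exists_prime_orderOf_dvd_card' p hG
    refine ⟨a, fun h => hp.one_lt.ne ?_, orderOf_dvd_iff_pow_eq_one.1 (ha ▸ hN)⟩
    rw [← ha, h, orderOf_one]

theorem exists_notMem_pow_mem_commutator_iff [Finite (G ⧸ commutator G)] (N : ℕ) :
    (∃ x ∉ commutator G, x ^ N ∈ commutator G) ↔
      ∃ p : ℕ, p.Prime ∧ p ∣ Nat.card (G ⧸ commutator G) ∧ p ∣ N := by
  rw [← exists_ne_one_pow_eq_one_iff, QuotientGroup.mk_surjective.exists]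
  simp only [← QuotientGroup.mk_pow, ne_eq, QuotientGroup.eq_one_iff]

theorem representable_iff_exists_ne_one {V : Type*} {X : SimpleGraph V} :
    Representable G X ↔ ∃ ρ : G →* (X ≃g X), ρ ≠ 1 := by
  simp only [Representable, ne_eq, MonoidHom.ext_iff, not_forall, MonoidHom.one_apply]

theorem representable_iff_exists_prime [Group.IsSolvable G] [Finite (G ⧸ commutator G)]
    {V : Type*} {X : SimpleGraph V} [Finite (X ≃g X)] :
    Representable G X ↔
      ∃ p : ℕ, p.Prime ∧ p ∣ Nat.card (G ⧸ commutator G) ∧ p ∣ Nat.card (X ≃g X) :=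
  representable_iff_exists_ne_one.trans exists_monoidHom_ne_one_iff

theorem Representable.of_mulEquiv {V : Type*} {X : SimpleGraph V} (e : G ≃* H)
    (h : Representable G X) : Representable H X := by
  obtain ⟨ρ, g, hg⟩ := h
  exact ⟨ρ.comp e.symm.toMonoidHom, e g, by simpa using hg⟩

theorem commutator_subset_of_mul_mem [Finite G] {S : Set G} (hcomm : commutatorSet G ⊆ S)
    (hmul : ∀ x ∈ S, ∀ y ∈ S, x * y ∈ S) : (commutator G : Set G) ⊆ S := by
  let M : Submonoid G :=
    ⟨⟨S, fun hx hy => hmul _ hx _ hy⟩, hcomm (one_mem_commutatorSet G)⟩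
  rw [commutator_eq_closure, ← Subgroup.coe_toSubmonoid, Subgroup.closure_toSubmonoid_of_finite]
  exact (Submonoid.closure_le (S := M)).2 hcomm

end Groups

section StabilizerChain

variable {Γ α : Type*} [Group Γ] [MulAction Γ α]

theorem card_fixingSubgroup_eq_ncard_orbit_mul (s : Set α) (a : α) :
    Nat.card (fixingSubgroup Γ s) =
      (MulAction.orbit (fixingSubgroup Γ s) a).ncard *
        Nat.card (fixingSubgroup Γ (insert a s)) := by
  have hle : fixingSubgroup Γ (insert a s) ≤ fixingSubgroup Γ s :=
    fixingSubgroup_antitone Γ α (Set.subset_insert a s)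
  have hstab : MulAction.stabilizer (fixingSubgroup Γ s) a =
      (fixingSubgroup Γ (insert a s)).subgroupOf (fixingSubgroup Γ s) := by
    ext g
    rw [Subgroup.mem_subgroupOf, SubMulAction.mem_fixingSubgroup_insert_iff]
    exact (and_iff_left g.2).symm
  rw [← MulAction.index_stabilizer, hstab, mul_comm, ← Subgroup.relIndex_bot_left,
    ← Subgroup.relIndex_bot_left]
  exact (Subgroup.relIndex_mul_relIndex _ _ _ bot_le hle).symm

theorem card_eq_prod_ncard_orbit_mul_card_fixingSubgroup [LinearOrder α] (s : Finset α) :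
    Nat.card Γ =
      (∏ i ∈ s, (MulAction.orbit (fixingSubgroup Γ (s ∩ Set.Iio i : Set α)) i).ncard) *
        Nat.card (fixingSubgroup Γ (s : Set α)) := by
  induction s using Finset.induction_on_max with
  | empty =>
    have htop : fixingSubgroup Γ (∅ : Set α) = ⊤ :=
      (Subgroup.eq_top_iff' _).2 fun g => (mem_fixingSubgroup_iff Γ).2 fun a ha => ha.elim
    rw [Finset.prod_empty, one_mul, Finset.coe_empty, htop, Subgroup.card_top]
  | insert a s hs ih =>
    have ha : insert a (s : Set α) ∩ Set.Iio a = s := by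
      rw [Set.insert_inter_of_notMem (by simp), Set.inter_eq_left]
      exact hs
    have hprod : ∏ i ∈ s, (MulAction.orbit
          (fixingSubgroup Γ (insert a s ∩ Set.Iio i : Set α)) i).ncard =
        ∏ i ∈ s, (MulAction.orbit (fixingSubgroup Γ (s ∩ Set.Iio i : Set α)) i).ncard :=
      Finset.prod_congr rfl fun i hi => by
        rw [Set.insert_inter_of_notMem (Set.notMem_Iio.2 (hs i hi).le)]
    rw [Finset.prod_insert fun h => (hs a h).false, Finset.coe_insert, ha, hprod, ih,
      card_fixingSubgroup_eq_ncard_orbit_mul _ a]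
    ring

theorem card_eq_prod_ncard_orbit [FaithfulSMul Γ α] [LinearOrder α] [Fintype α] :
    Nat.card Γ = ∏ i : α, (MulAction.orbit (fixingSubgroup Γ (Set.Iio i)) i).ncard := by
  have hbot : fixingSubgroup Γ (Set.univ : Set α) = ⊥ := by
    refine (Subgroup.eq_bot_iff_forall _).2 fun g hg => ?_
    exact FaithfulSMul.eq_of_smul_eq_smul fun a : α => by
      rw [(mem_fixingSubgroup_iff Γ).1 hg a (Set.mem_univ a), one_smul]
  rw [card_eq_prod_ncard_orbit_mul_card_fixingSubgroup (α := α) Finset.univ, Finset.coe_univ, hbot,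
    Subgroup.card_bot, mul_one]
  exact Finset.prod_congr rfl fun i _ => by rw [Set.univ_inter]

end StabilizerChain

section Pendants

variable {V W : Type*}

/-- The graph `X` with `w v` pendant vertices attached to every vertex `v`, for weights `w v ≤ k`.
The vertex `v` of `X` is the pair `(v, 0)` and its pendant vertices are the pairs
`(v, 1), …, (v, w v)`; the remaining pairs are isolated vertices. -/
def withPendants (X : SimpleGraph V) (w : V → ℕ) (k : ℕ) : SimpleGraph (V × Fin (k + 1)) where
  Adj p q := (p.2 = 0 ∧ q.2 = 0 ∧ X.Adj p.1 q.1) ∨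
    (p.1 = q.1 ∧ (p.2 = 0 ∧ q.2 ≠ 0 ∧ (q.2 : ℕ) ≤ w p.1 ∨ q.2 = 0 ∧ p.2 ≠ 0 ∧ (p.2 : ℕ) ≤ w p.1))
  symm := ⟨by
    rintro ⟨u, a⟩ ⟨v, b⟩ (⟨ha, hb, h⟩ | ⟨rfl, h⟩)
    · exact .inl ⟨hb, ha, h.symm⟩
    · exact .inr ⟨rfl, h.symm⟩⟩
  loopless := ⟨by
    rintro ⟨u, a⟩ (⟨-, -, h⟩ | ⟨-, h | h⟩)
    exacts [h.ne rfl, h.2.1 h.1, h.2.1 h.1]⟩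

variable {X : SimpleGraph V} {Y : SimpleGraph W} {w : V → ℕ} {w' : W → ℕ} {k : ℕ}

theorem withPendants_adj_zero_zero {u v : V} :
    (withPendants X w k).Adj (u, 0) (v, 0) ↔ X.Adj u v := by
  simp [withPendants]

theorem neighborSet_withPendants_subsingleton_iff (hk : 2 ≤ k) (hw : ∀ v, 2 ≤ w v)
    (p : V × Fin (k + 1)) : ((withPendants X w k).neighborSet p).Subsingleton ↔ p.2 ≠ 0 := by
  obtain ⟨v, a⟩ := p
  refine ⟨?_, fun ha => ?_⟩
  · rintro h rfl
    have hv := hw v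
    have hpendant (b : Fin (k + 1)) (hb : b ≠ 0) (hb2 : (b : ℕ) ≤ 2) :
        (v, b) ∈ (withPendants X w k).neighborSet (v, 0) :=
      .inr ⟨rfl, .inl ⟨rfl, hb, hb2.trans hv⟩⟩
    have h12 := h (hpendant ⟨1, by omega⟩ (by simp [Fin.ext_iff]) (by simp))
      (hpendant ⟨2, by omega⟩ (by simp [Fin.ext_iff]) le_rfl)
    exact absurd h12 (by simp)
  · refine Set.subsingleton_of_forall_eq (v, 0) ?_
    rintro ⟨u, b⟩ h
    simp only [SimpleGraph.mem_neighborSet, withPendants] at h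
    grind

theorem ncard_pendants (hw : ∀ v, w v ≤ k) (v : V) :
    {q ∈ (withPendants X w k).neighborSet (v, 0) | q.2 ≠ 0}.ncard = w v := by
  have h : {q ∈ (withPendants X w k).neighborSet (v, 0) | q.2 ≠ 0} =
      Prod.mk v '' (Finset.Ioc (0 : Fin (k + 1)) ⟨w v, Nat.lt_succ_of_le (hw v)⟩) := by
    ext ⟨u, b⟩
    simp only [withPendants, ne_eq, SimpleGraph.mem_neighborSet, true_and, not_true_eq_false,
      Fin.coe_ofNat_eq_mod, Nat.zero_mod, zero_le, and_true, and_false, or_false,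
      Set.mem_ofPred_eq, Finset.coe_Ioc, Set.mem_image, Set.mem_Ioc, Fin.pos_iff_ne_zero,
      Fin.le_def, Prod.mk.injEq, exists_eq_right_right]
    grind
  rw [h, Set.ncard_image_of_injective _ (Prod.mk_right_injective v), Set.ncard_coe_finset,
    Fin.card_Ioc]
  simp

theorem iso_neighborSet_subsingleton_iff (φ : X ≃g Y) (v : V) :
    (Y.neighborSet (φ v)).Subsingleton ↔ (X.neighborSet v).Subsingleton := by
  simp only [← Set.subsingleton_coe]
  exact (φ.mapNeighborSet v).subsingleton_congr.symm

theorem exists_iso_of_iso_withPendants (hk : 2 ≤ k) (hw : ∀ v, 2 ≤ w v ∧ w v ≤ k)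
    (hw' : ∀ v, 2 ≤ w' v ∧ w' v ≤ k) (φ : withPendants X w k ≃g withPendants Y w' k) :
    ∃ σ : X ≃g Y, ∀ v, w' (σ v) = w v := by
  have hcore (p) : (φ p).2 ≠ 0 ↔ p.2 ≠ 0 := by
    rw [← neighborSet_withPendants_subsingleton_iff hk fun v => (hw v).1,
      ← neighborSet_withPendants_subsingleton_iff hk fun v => (hw' v).1,
      iso_neighborSet_subsingleton_iff]
  have hto (v) : ∃ u, φ (v, 0) = (u, 0) := ⟨_, Prod.ext rfl (not_not.1 (by simp [hcore]))⟩
  have hinv (u) : ∃ v, φ.symm (u, 0) = (v, 0) :=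
    ⟨_, Prod.ext rfl (not_not.1 (by simp [← hcore]))⟩
  choose f hf using hto
  choose g hg using hinv
  let σ : X ≃g Y :=
    { toFun := f
      invFun := g
      left_inv := fun v => (Prod.mk.inj (by rw [← hg, ← hf, φ.symm_apply_apply])).1
      right_inv := fun u => (Prod.mk.inj (by rw [← hf, ← hg, φ.apply_symm_apply])).1
      map_rel_iff' := fun {u v} => by
        rw [← withPendants_adj_zero_zero (w := w) (k := k), ← φ.map_adj_iff, hf, hf,
          withPendants_adj_zero_zero]
        rfl }
  refine ⟨σ, fun v => ?_⟩
  have himage : φ '' {q ∈ (withPendants X w k).neighborSet (v, 0) | q.2 ≠ 0} =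
      {q ∈ (withPendants Y w' k).neighborSet (σ v, 0) | q.2 ≠ 0} := by
    have hσ : (σ v, 0) = φ (v, 0) := (hf v).symm
    ext q
    obtain ⟨p, rfl⟩ := φ.surjective q
    simp only [hσ, φ.injective.mem_set_image, Set.mem_ofPred_eq, SimpleGraph.mem_neighborSet,
      φ.map_adj_iff, hcore]
  rw [← ncard_pendants fun v => (hw v).2, ← ncard_pendants fun v => (hw' v).2, ← himage,
    Set.ncard_image_of_injective _ φ.injective]

theorem nonempty_iso_withPendants_iff (hk : 2 ≤ k) (hw : ∀ v, 2 ≤ w v ∧ w v ≤ k)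
    (hw' : ∀ v, 2 ≤ w' v ∧ w' v ≤ k) :
    Nonempty (withPendants X w k ≃g withPendants Y w' k) ↔ ∃ σ : X ≃g Y, ∀ v, w' (σ v) = w v := by
  refine ⟨fun ⟨φ⟩ => exists_iso_of_iso_withPendants hk hw hw' φ, fun ⟨σ, hσ⟩ => ?_⟩
  refine ⟨σ.toEquiv.prodCongr (Equiv.refl _), ?_⟩
  rintro ⟨u, a⟩ ⟨v, b⟩
  simp [withPendants, hσ, σ.map_adj_iff]

end Pendants

section MarkedGraphs

variable {n : ℕ} (X : SimpleGraph (Fin n))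

/-- Weights that make the vertex `j` and every vertex below `i` recognizable; the vertex `j` gets
the weight that singles out `i` in `mark i i`. -/
def mark (i j v : Fin n) : ℕ := if v = j then i + 3 else if v < i then v + 3 else 2

theorem exists_mark_eq_iff_mem_orbit (i j : Fin n) :
    (∃ σ : X ≃g X, ∀ v, mark i j (σ v) = mark i i v) ↔
      j ∈ MulAction.orbit (fixingSubgroup (X ≃g X) (Set.Iio i)) i := by
  constructor
  · rintro ⟨σ, hσ⟩
    have hfix : ∀ v < i, σ v = v := fun v hv => by
      have h := hσ v
      grind [mark]
    have hij : σ i = j := by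
      have h := hσ i
      grind [mark]
    exact ⟨⟨σ, (mem_fixingSubgroup_iff _).2 hfix⟩, hij⟩
  · rintro ⟨⟨σ, hσ⟩, rfl⟩
    have hfix : ∀ v < i, σ v = v := (mem_fixingSubgroup_iff _).1 hσ
    refine ⟨σ, fun v => ?_⟩
    change mark i (σ i) (σ v) = mark i i v
    have h1 : σ v = σ i ↔ v = i := σ.injective.eq_iff
    have h2 : σ v < i → σ v = v := fun h => σ.injective (hfix _ h)
    grind [mark]

/-- The graph `X` with pendant vertices attached according to `mark i j`, on the vertices
`v * (n + 3) + a` for the pairs `(v, a)`. -/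
def markedGraph (i j : Fin n) : SimpleGraph (Fin (n * (n + 3))) :=
  (withPendants X (mark i j) (n + 2)).comap finProdFinEquiv.symm

theorem nonempty_iso_markedGraph_iff (i j : Fin n) :
    Nonempty (markedGraph X i i ≃g markedGraph X i j) ↔
      j ∈ MulAction.orbit (fixingSubgroup (X ≃g X) (Set.Iio i)) i := by
  have hmark (j v : Fin n) : 2 ≤ mark i j v ∧ mark i j v ≤ n + 2 := by grind [mark]
  rw [← exists_mark_eq_iff_mem_orbit,
    ← nonempty_iso_withPendants_iff (Nat.le_add_left 2 n) (hmark i) (hmark j)]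
  let e (j : Fin n) : markedGraph X i j ≃g withPendants X (mark i j) (n + 2) :=
    SimpleGraph.Iso.comap finProdFinEquiv.symm _
  exact ⟨fun ⟨f⟩ => ⟨((e i).symm.trans f).trans (e j)⟩,
    fun ⟨f⟩ => ⟨((e i).trans f).trans (e j).symm⟩⟩

/-- The number of points in the orbit of `i` under the automorphisms of `X` that fix the vertices
before `i`. -/
noncomputable def orbitLength (i : Fin n) : ℕ :=
  (MulAction.orbit (fixingSubgroup (X ≃g X) (Set.Iio i)) i).ncard

open Classical in
theorem countP_orbit_add_one (i : Fin n) :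
    (List.finRange n).countP (fun j =>
      j ∈ MulAction.orbit (fixingSubgroup (X ≃g X) (Set.Iio i)) i ∧ j ≠ i) + 1 =
      orbitLength X i := by
  rw [orbitLength, ← Set.ncard_sdiff_singleton_add_one (MulAction.mem_orbit_self i),
    List.countP_eq_length_filter, Set.ncard_eq_toFinset_card']
  congr 1
  trans (Finset.univ.filter fun j =>
      j ∈ MulAction.orbit (fixingSubgroup (X ≃g X) (Set.Iio i)) i ∧ j ≠ i).card
  · rfl
  · congr 1
    ext
    simp

theorem prod_orbitLength : ∏ i, orbitLength X i = Nat.card (X ≃g X) :=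
  card_eq_prod_ncard_orbit.symm

end MarkedGraphs

section Folds

variable {α M : Type*} [Monoid M]

theorem foldl_ite_mul (p : α → Bool) (g h : M) (l : List α) :
    l.foldl (fun a x => if p x then a * g else a) h = h * g ^ l.countP p := by
  induction l generalizing h with
  | nil => simp
  | cons x l ih =>
    rw [List.foldl_cons, ih, List.countP_cons]
    split_ifs <;> simp [pow_succ', mul_assoc]

theorem foldl_pow (f : α → ℕ) (g : M) (l : List α) :
    l.foldl (fun a x => a ^ f x) g = g ^ (l.map f).prod := by
  induction l generalizing g with
  | nil => simp
  | cons x l ih => rw [List.foldl_cons, ih, List.map_cons, List.prod_cons, pow_mul]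

theorem foldl_or (q : α → Prop) (p : Prop) (l : List α) :
    l.foldl (fun p x => p ∨ q x) p ↔ p ∨ ∃ x ∈ l, q x := by
  induction l generalizing p with
  | nil => simp
  | cons x l ih => simp [ih, or_assoc]

end Folds

section Words

variable {α : Type*} {m n k : ℕ}

theorem finRange_mul (m n : ℕ) :
    List.finRange (m * n) = (List.finRange m).flatMap fun i =>
      (List.finRange n).map fun j => finProdFinEquiv (i, j) := by
  rw [← List.ofFn_id, List.ofFn_mul, List.flatMap, ← List.ofFn_eq_map]
  simp only [← List.ofFn_eq_map]
  congr! with i j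
  exact Fin.ext (by simp [add_comm, mul_comm])

/-- The entries of an array, row by row. -/
def rowMajor (f : Fin m → Fin n → α) : List α :=
  (List.finRange m).flatMap fun i => (List.finRange n).map (f i)

theorem rowMajor_eq_map (f : Fin m → Fin n → α) :
    rowMajor f = (List.finRange (m * n)).map fun k =>
      f (finProdFinEquiv.symm k).1 (finProdFinEquiv.symm k).2 := by
  simp only [rowMajor, finRange_mul, List.map_flatMap, List.map_map, Function.comp_def,
    Equiv.symm_apply_apply]

theorem length_rowMajor (f : Fin m → Fin n → α) : (rowMajor f).length = m * n := by
  rw [rowMajor_eq_map, List.length_map, List.length_finRange]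

theorem getElem?_rowMajor (f : Fin m → Fin n → α) (i : Fin m) (j : Fin n) :
    (rowMajor f)[(j + n * i : ℕ)]? = some (f i j) := by
  have h : (j + n * i : ℕ) = finProdFinEquiv (i, j) := rfl
  rw [rowMajor_eq_map, h, List.getElem?_map, List.getElem?_eq_getElem
    ((finProdFinEquiv (i, j)).2.trans_eq List.length_finRange.symm), List.getElem_finRange,
    Option.map_some, Fin.cast_mk, Fin.eta, Equiv.symm_apply_apply]

theorem rowMajor_injective : Function.Injective (rowMajor : (Fin m → Fin n → α) → List α) :=
  fun f g h => funext₂ fun i j => Option.some.inj <| by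
    rw [← getElem?_rowMajor, h, getElem?_rowMajor]

section Tables

variable {G H : Type} [Group G] [Group H] (e : Fin m ≃ G) (f : Fin m ≃ H)

theorem tableWord_eq_rowMajor : tableWord e = rowMajor fun i j => (e.symm (e i * e j) : ℕ) := rfl

theorem length_tableWord : (tableWord e).length = m * m := length_rowMajor _

variable {e f} in
theorem nonempty_mulEquiv_of_tableWord_eq (h : tableWord e = tableWord f) :
    Nonempty (G ≃* H) := by
  refine ⟨⟨e.symm.trans f, fun x y => ?_⟩⟩
  have hxy := congrFun₂ (rowMajor_injective h) (e.symm x) (e.symm y)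
  simp only [Equiv.apply_symm_apply] at hxy
  simpa using congrArg f (Fin.ext hxy)

end Tables

section Adjacency

variable (X : SimpleGraph (Fin n)) (Y : SimpleGraph (Fin k))

open Classical in
theorem adjWord_eq_rowMajor : adjWord X = rowMajor fun i j => if X.Adj i j then 1 else 0 := rfl

theorem length_adjWord : (adjWord X).length = n * n := length_rowMajor _

theorem adjWord_injective : Function.Injective (adjWord (n := n)) := by
  classical
  intro X Y h
  ext i j
  have hij := congrFun₂ (rowMajor_injective h) i j
  split_ifs at hij with hX hY hY <;> simp_all

open Classical in
theorem adjWord_comap_finProdFinEquiv (Z : SimpleGraph (Fin n × Fin k)) :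
    adjWord (Z.comap finProdFinEquiv.symm) =
      (List.finRange n).flatMap fun u => (List.finRange k).flatMap fun a =>
        (List.finRange n).flatMap fun v => (List.finRange k).map fun b =>
          if Z.Adj (u, a) (v, b) then 1 else 0 := by
  simp only [adjWord, finRange_mul, List.flatMap_assoc, List.map_flatMap, List.map_map,
    List.flatMap_map, Function.comp_def, SimpleGraph.comap_adj, Equiv.symm_apply_apply]

theorem graphPairWord_mem_yes_iff :
    graphPairWord X Y ∈ graphIsomorphism.yes ↔ Nonempty (X ≃g Y) := by
  refine ⟨?_, fun h => ⟨n, k, X, Y, rfl, h⟩⟩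
  rintro ⟨n', k', X', Y', h, hXY⟩
  simp only [graphPairWord, List.cons.injEq] at h
  obtain ⟨rfl, rfl, h⟩ := h
  obtain ⟨hX, hY⟩ := List.append_inj h (by rw [length_adjWord, length_adjWord])
  rwa [adjWord_injective hX, adjWord_injective hY]

end Adjacency

section Inputs

variable {G : Type} [hG : Group G] (e : Fin m ≃ G) (X : SimpleGraph (Fin n))

theorem groupGraphWord_mem_yes_iff [Group.IsSolvable G] :
    groupGraphWord e X ∈ solvableRepresentability.yes ↔ Representable G X := by
  refine ⟨?_, fun h => ⟨G, hG, m, n, e, X, inferInstance, rfl, h⟩⟩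
  rintro ⟨H, _, m', n', f, Y, -, h, hH⟩
  simp only [groupGraphWord, List.cons.injEq] at h
  obtain ⟨rfl, rfl, h⟩ := h
  obtain ⟨htable, hadj⟩ := List.append_inj h (by rw [length_tableWord, length_tableWord])
  obtain ⟨φ⟩ := nonempty_mulEquiv_of_tableWord_eq htable
  rw [adjWord_injective hadj]
  exact hH.of_mulEquiv φ.symm

theorem getD_groupGraphWord_table (i j : Fin m) :
    (groupGraphWord e X).getD (2 + (j + m * i)) 0 = e.symm (e i * e j) := by
  have h := getElem?_rowMajor (fun i j => (e.symm (e i * e j) : ℕ)) i j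
  rw [← tableWord_eq_rowMajor] at h
  rw [groupGraphWord, add_comm 2, List.getD_cons_succ, List.getD_cons_succ,
    List.getD_eq_getElem?_getD, List.getElem?_append_left (List.getElem?_eq_some_iff.1 h).1, h,
    Option.getD_some]

open Classical in
theorem getD_groupGraphWord_adj (i j : Fin n) :
    (groupGraphWord e X).getD (2 + (m * m + (j + n * i))) 0 = if X.Adj i j then 1 else 0 := by
  have h := getElem?_rowMajor (fun i j => if X.Adj i j then 1 else 0) i j
  rw [← adjWord_eq_rowMajor] at h
  rw [groupGraphWord, add_comm 2, List.getD_cons_succ, List.getD_cons_succ,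
    List.getD_eq_getElem?_getD, ← length_tableWord e, List.getElem?_append_right (by simp),
    Nat.add_sub_cancel_left, h, Option.getD_some]

end Inputs

section WordSize

theorem length_le_wordSize (w : Word) : w.length ≤ wordSize w := by
  simp [wordSize, List.sum_map_add]

theorem order_le_wordSize_groupGraphWord {G : Type} [Group G] (e : Fin m ≃ G)
    (X : SimpleGraph (Fin n)) :
    m ≤ wordSize (groupGraphWord e X) := by
  refine le_trans ?_ (length_le_wordSize _)
  simp only [groupGraphWord, List.length_cons, List.length_append, length_tableWord]
  exact (Nat.le_mul_self m).trans (by omega)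

theorem vertices_le_wordSize_groupGraphWord {G : Type} [Group G] (e : Fin m ≃ G)
    (X : SimpleGraph (Fin n)) :
    n ≤ wordSize (groupGraphWord e X) := by
  refine le_trans ?_ (length_le_wordSize _)
  simp only [groupGraphWord, List.length_cons, List.length_append, length_adjWord]
  exact (Nat.le_mul_self n).trans (by omega)

end WordSize

end Words

namespace OracleRAM

@[simp]
theorem State.reg_setReg (s : State) (x v y : ℕ) :
    (s.setReg x v).reg y = if y = x then v else s.reg y :=
  Function.update_apply ..

@[simp]
theorem State.mem_setReg (s : State) (x v : ℕ) : (s.setReg x v).mem = s.mem := rfl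

@[simp]
theorem State.reg_setMem (s : State) (a i v : ℕ) : (s.setMem a i v).reg = s.reg := rfl

@[simp]
theorem State.mem_setMem (s : State) (a i v b : ℕ) :
    (s.setMem a i v).mem b = if b = a then Function.update (s.mem a) i v else s.mem b :=
  Function.update_apply ..

section RunsWithin

variable {O : Set Word} {P Q : Prog} {s t u : State} {T T' : ℕ}

/-- With the oracle `O`, the program `P` started in the state `s` halts in the state `t` after at
most `T` steps. -/
def RunsWithin (O : Set Word) (P : Prog) (s : State) (T : ℕ) (t : State) : Prop :=
  ∃ k ≤ T, Exec O P s k t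

theorem Exec.runsWithin {k : ℕ} (h : Exec O P s k t) : RunsWithin O P s k t := ⟨k, le_rfl, h⟩

theorem RunsWithin.mono (h : RunsWithin O P s T t) (hT : T ≤ T') : RunsWithin O P s T' t :=
  let ⟨k, hk, hP⟩ := h
  ⟨k, hk.trans hT, hP⟩

theorem RunsWithin.seq (hP : RunsWithin O P s T t) (hQ : RunsWithin O Q t T' u) :
    RunsWithin O (.seq P Q) s (T + T') u :=
  let ⟨k, hk, hP⟩ := hP
  let ⟨l, hl, hQ⟩ := hQ
  ⟨k + l, add_le_add hk hl, hP.seq hQ⟩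

theorem RunsWithin.ite_true {x : ℕ} (hx : s.reg x ≠ 0) (h : RunsWithin O P s T t) :
    RunsWithin O (.ite x P Q) s (1 + T) t :=
  let ⟨k, hk, h⟩ := h
  ⟨1 + k, Nat.add_le_add_left hk 1, h.ite_true hx⟩

theorem RunsWithin.ite_false {x : ℕ} (hx : s.reg x = 0) (h : RunsWithin O Q s T t) :
    RunsWithin O (.ite x P Q) s (1 + T) t :=
  let ⟨k, hk, h⟩ := h
  ⟨1 + k, Nat.add_le_add_left hk 1, h.ite_false hx⟩

theorem RunsWithin.exists_loop {x : ℕ} {I : ℕ → State → Prop} (hreg : ∀ r s, I r s → s.reg x = r)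
    (hbody : ∀ r s, I (r + 1) s → ∃ t, RunsWithin O P s T t ∧ I r t) (r : ℕ) (s : State)
    (hs : I r s) : ∃ t, RunsWithin O (.loop x P) s (1 + r * (1 + T)) t ∧ I 0 t := by
  induction r generalizing s with
  | zero => exact ⟨s, (Exec.loop_done (hreg _ _ hs)).runsWithin.mono (by omega), hs⟩
  | succ r ih =>
    obtain ⟨t, ⟨k, hk, hP⟩, ht⟩ := hbody r s hs
    obtain ⟨u, ⟨l, hl, hloop⟩, hu⟩ := ih t ht
    refine ⟨u, ⟨1 + k + l, ?_, hP.loop_step ?_ hloop⟩, hu⟩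
    · linarith
    · rw [hreg _ _ hs]
      exact r.succ_ne_zero

/-- `x := y`, for distinct registers `x` and `y`. -/
def copy (x y : ℕ) : Prog := .seq (.const x 0) (.add x y x)

theorem runsWithin_copy {x y : ℕ} (h : y ≠ x) :
    RunsWithin O (copy x y) s 2 (s.setReg x (s.reg y)) := by
  have hadd := Exec.add (O := O) (s.setReg x 0) x y x
  have hs : (s.setReg x 0).setReg x ((s.setReg x 0).reg y + (s.setReg x 0).reg x) =
      s.setReg x (s.reg y) := by
    simp [State.setReg, Function.update_of_ne h]
  exact ((Exec.const s x 0).runsWithin.seq (hs ▸ hadd).runsWithin)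

end RunsWithin

section Language

variable {Z I V : Type*}

/-- What a command can read but not change: the named sizes that bound its loops, the indices of
the loops around it, the letters of the input, and the oracle. -/
structure Env (Z I : Type*) where
  size : Z → ℕ
  index : I → ℕ
  input : ℕ → ℕ
  oracle : Set Word

/-- What a command can change: its variables, an array, and the word prepared for the oracle. -/
structure Store (V : Type*) where
  var : V → ℕ
  cell : ℕ → ℕ
  out : Word

/-- Bind a loop index. -/
def Env.bind [DecidableEq I] (E : Env Z I) (x : I) (k : ℕ) : Env Z I :=
  { E with index := Function.update E.index x k }

/-- Assign a value to a variable. -/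
def Store.setVar [DecidableEq V] (s : Store V) (x : V) (v : ℕ) : Store V :=
  { s with var := Function.update s.var x v }

/-- Assign a value to a cell of the array. -/
def Store.setCell (s : Store V) (i v : ℕ) : Store V :=
  { s with cell := Function.update s.cell i v }

/-- Append a word to the word prepared for the oracle. -/
def Store.emit (s : Store V) (w : Word) : Store V := { s with out := s.out ++ w }

/-- Expressions; `scale z e` is the product of the size `z` and `e`, and `cond c e f` is `e` if `c`
is nonzero, and `f` otherwise. -/
inductive Expr (Z I V : Type*)
  | lit (c : ℕ)
  | size (z : Z)
  | index (x : I)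
  | var (x : V)
  | input (e : Expr Z I V)
  | cell (e : Expr Z I V)
  | add (e f : Expr Z I V)
  | sub (e f : Expr Z I V)
  | scale (z : Z) (e : Expr Z I V)
  | cond (c e f : Expr Z I V)

/-- Commands: assignments to variables and to cells of the array, commands that clear and extend
the word prepared for the oracle, queries, and loops `loop x z P` that run `P` for the indices
`x = 0, …, z - 1`. -/
inductive Cmd (Z I V : Type*)
  | set (x : V) (e : Expr Z I V)
  | store (i e : Expr Z I V)
  | clear
  | emitSize (z : Z)
  | emitBit (e : Expr Z I V)
  | query (x : V)
  | seq (P Q : Cmd Z I V)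
  | loop (x : I) (z : Z) (P : Cmd Z I V)

/-- The value of an expression. -/
def Expr.eval (E : Env Z I) (s : Store V) : Expr Z I V → ℕ
  | lit c => c
  | size z => E.size z
  | index x => E.index x
  | var x => s.var x
  | input e => E.input (e.eval E s)
  | cell e => s.cell (e.eval E s)
  | add e f => e.eval E s + f.eval E s
  | sub e f => e.eval E s - f.eval E s
  | scale z e => E.size z * e.eval E s
  | cond c e f => if c.eval E s ≠ 0 then e.eval E s else f.eval E s

open Classical in
/-- The effect of a command. -/
noncomputable def Cmd.eval [DecidableEq I] [DecidableEq V] :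
    Cmd Z I V → Env Z I → Store V → Store V
  | set x e, E, s => s.setVar x (e.eval E s)
  | store i e, E, s => s.setCell (i.eval E s) (e.eval E s)
  | clear, _, s => { s with out := [] }
  | emitSize z, E, s => s.emit [E.size z]
  | emitBit e, E, s => s.emit [if e.eval E s ≠ 0 then 1 else 0]
  | query x, E, s => s.setVar x (if s.out ∈ E.oracle then 1 else 0)
  | seq P Q, E, s => Q.eval E (P.eval E s)
  | loop x z P, E, s => (List.range (E.size z)).foldl (fun s k => P.eval (E.bind x k) s) s

/-- The objects that are kept in registers; `scratch d` holds intermediate results. -/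
inductive Slot (Z I V : Type*)
  | size (z : Z)
  | index (x : I)
  | var (x : V)
  | scratch (d : ℕ)
  | outLength
  deriving Countable

end Language

section Compile

local notation:60 P:61 ";;" Q:60 => Prog.seq P Q

variable {Z I V : Type*} (r : Slot Z I V ↪ ℕ)

/-- Compilation of an expression, for a layout `r` of the slots in registers: the value ends up in
the slot `scratch d`, and only the slots `scratch k` with `d ≤ k` are changed. -/
def Expr.compile : Expr Z I V → ℕ → Prog
  | lit c, d => .const (r (.scratch d)) c
  | size z, d => copy (r (.scratch d)) (r (.size z))
  | index x, d => copy (r (.scratch d)) (r (.index x))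
  | var x, d => copy (r (.scratch d)) (r (.var x))
  | input e, d => e.compile d ;; .load (r (.scratch d)) 0 (r (.scratch d))
  | cell e, d => e.compile d ;; .load (r (.scratch d)) 1 (r (.scratch d))
  | add e f, d =>
    e.compile d ;; f.compile (d + 1) ;;
      .add (r (.scratch d)) (r (.scratch d)) (r (.scratch (d + 1)))
  | sub e f, d =>
    e.compile d ;; f.compile (d + 1) ;;
      .sub (r (.scratch d)) (r (.scratch d)) (r (.scratch (d + 1)))
  | scale z e, d =>
    e.compile (d + 1) ;; copy (r (.scratch (d + 2))) (r (.size z)) ;;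
      .const (r (.scratch (d + 3))) 1 ;; .const (r (.scratch d)) 0 ;;
      .loop (r (.scratch (d + 2)))
        (.add (r (.scratch d)) (r (.scratch d)) (r (.scratch (d + 1))) ;;
          .sub (r (.scratch (d + 2))) (r (.scratch (d + 2))) (r (.scratch (d + 3))))
  | cond c e f, d => c.compile d ;; .ite (r (.scratch d)) (e.compile d) (f.compile d)

/-- A bound on the running time of a compiled expression, in terms of a bound on the sizes. -/
noncomputable def Expr.time : Expr Z I V → Polynomial ℕ
  | lit _ => 1
  | size _ | index _ | var _ => 2
  | input e | cell e => e.time + 1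
  | add e f | sub e f => e.time + f.time + 1
  | scale _ e => e.time + 3 * .X + 5
  | cond c e f => c.time + e.time + f.time + 1

/-- The instruction sequence that appends the contents of a register to the prepared word. -/
def append (x d : ℕ) : Prog :=
  .store 2 (r .outLength) x ;; .const (r (.scratch d)) 1 ;;
    .add (r .outLength) (r .outLength) (r (.scratch d))

/-- The instruction sequence that ends a round of a compiled loop: it decreases the counter
`scratch (d + 1)` and increases the index `x`. -/
def advance (x : I) (d : ℕ) : Prog :=
  .const (r (.scratch (d + 2))) 1 ;;
    .sub (r (.scratch (d + 1))) (r (.scratch (d + 1))) (r (.scratch (d + 2))) ;;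
    .add (r (.index x)) (r (.index x)) (r (.scratch (d + 2)))

/-- Compilation of a command. The word prepared for the oracle lives in the memory bank `2`. A loop
saves the index that it binds in `scratch d`, and counts the remaining rounds in
`scratch (d + 1)`. -/
def Cmd.compile : Cmd Z I V → ℕ → Prog
  | set x e, d => e.compile r d ;; copy (r (.var x)) (r (.scratch d))
  | store i e, d =>
    i.compile r d ;; e.compile r (d + 1) ;; .store 1 (r (.scratch d)) (r (.scratch (d + 1)))
  | clear, _ => .const (r .outLength) 0
  | emitSize z, d => append r (r (.size z)) d
  | emitBit e, d => (Expr.cond e (.lit 1) (.lit 0)).compile r d ;; append r (r (.scratch d)) d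
  | query x, _ => .query (r (.var x)) 2 (r .outLength)
  | seq P Q, d => P.compile d ;; Q.compile d
  | loop x z P, d =>
    copy (r (.scratch d)) (r (.index x)) ;; copy (r (.scratch (d + 1))) (r (.size z)) ;;
      .const (r (.index x)) 0 ;;
      .loop (r (.scratch (d + 1))) (P.compile (d + 2) ;; advance r x d) ;;
      copy (r (.index x)) (r (.scratch d))

/-- A bound, in terms of a bound on the sizes, on the bit length of the word that a command
appends to the word prepared for the oracle. -/
noncomputable def Cmd.outBits : Cmd Z I V → Polynomial ℕ
  | set _ _ | store _ _ | clear | query _ => 0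
  | emitSize _ => .X + 1
  | emitBit _ => 2
  | seq P Q => P.outBits + Q.outBits
  | loop _ _ P => .X * P.outBits

/-- A bound on the running time of a compiled command, in terms of a bound on the sizes, if the bit
length of the word prepared for the oracle is at most `L` at the beginning. -/
noncomputable def Cmd.time : Cmd Z I V → Polynomial ℕ → Polynomial ℕ
  | set _ e, _ => e.time + 2
  | store i e, _ => i.time + e.time + 1
  | clear, _ => 1
  | emitSize _, _ => 3
  | emitBit e, _ => e.time + 6
  | query _, L => L + 1
  | seq P Q, L => P.time L + Q.time (L + P.outBits)
  | loop _ _ P, L => .X * (P.time (L + .X * P.outBits) + 4) + 8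

/-- The states `t` and `u` differ at most in the slots `scratch k` with `d ≤ k`. -/
structure AgreeBelow (d : ℕ) (t u : State) : Prop where
  mem : u.mem = t.mem
  reg : ∀ x : Slot Z I V, (∀ k, d ≤ k → x ≠ .scratch k) → u.reg (r x) = t.reg (r x)

/-- The state `t` of the machine represents the environment `E` and the store `s`. -/
structure Represents (E : Env Z I) (s : Store V) (t : State) : Prop where
  size : ∀ z, t.reg (r (.size z)) = E.size z
  index : ∀ x, t.reg (r (.index x)) = E.index x
  var : ∀ x, t.reg (r (.var x)) = s.var x
  input : t.mem 0 = E.input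
  cell : t.mem 1 = s.cell
  outLength : t.reg (r .outLength) = s.out.length
  out : t.word 2 s.out.length = s.out

variable {r} {O : Set Word} {E : Env Z I} {s : Store V} {t u v : State} {N d k : ℕ}

theorem AgreeBelow.refl (d : ℕ) (t : State) : AgreeBelow r d t t := ⟨rfl, fun _ _ => rfl⟩

theorem AgreeBelow.trans (htu : AgreeBelow r d t u) (huv : AgreeBelow r k u v) (hdk : d ≤ k) :
    AgreeBelow r d t v :=
  ⟨huv.mem.trans htu.mem, fun x hx =>
    (huv.reg x fun l hl => hx l (hdk.trans hl)).trans (htu.reg x hx)⟩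

theorem AgreeBelow.setReg (h : AgreeBelow r d t u) (hdk : d ≤ k) (c : ℕ) :
    AgreeBelow r d t (u.setReg (r (.scratch k)) c) := by
  refine ⟨h.mem, fun x hx => ?_⟩
  rw [State.reg_setReg, if_neg (r.injective.ne (hx k hdk)), h.reg x hx]

theorem AgreeBelow.scratch (h : AgreeBelow r d t u) (hkd : k < d) :
    u.reg (r (.scratch k)) = t.reg (r (.scratch k)) :=
  h.reg _ fun l hl => by grind

theorem Represents.of_agreeBelow (h : Represents r E s t) (htu : AgreeBelow r d t u) :
    Represents r E s u where
  size z := (htu.reg _ (by simp)).trans (h.size z)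
  index x := (htu.reg _ (by simp)).trans (h.index x)
  var x := (htu.reg _ (by simp)).trans (h.var x)
  input := htu.mem ▸ h.input
  cell := htu.mem ▸ h.cell
  outLength := (htu.reg _ (by simp)).trans h.outLength
  out := by simpa only [State.word, htu.mem] using h.out

theorem exists_runsWithin_accumulate (h : t.reg (r (.scratch (d + 3))) = 1) :
    ∃ u, RunsWithin O
      (.loop (r (.scratch (d + 2)))
        (.add (r (.scratch d)) (r (.scratch d)) (r (.scratch (d + 1))) ;;
          .sub (r (.scratch (d + 2))) (r (.scratch (d + 2))) (r (.scratch (d + 3)))))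
      t (1 + t.reg (r (.scratch (d + 2))) * 3) u ∧
      u.reg (r (.scratch d)) = t.reg (r (.scratch d)) +
        t.reg (r (.scratch (d + 2))) * t.reg (r (.scratch (d + 1))) ∧
      AgreeBelow r d t u := by
  let a := t.reg (r (.scratch (d + 1)))
  let total := t.reg (r (.scratch d)) + t.reg (r (.scratch (d + 2))) * a
  let Inv (k : ℕ) (u : State) : Prop :=
    u.reg (r (.scratch (d + 2))) = k ∧ u.reg (r (.scratch (d + 1))) = a ∧
      u.reg (r (.scratch (d + 3))) = 1 ∧ u.reg (r (.scratch d)) + k * a = total ∧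
      AgreeBelow r d t u
  have hround (k : ℕ) (u : State) (hu : Inv (k + 1) u) : ∃ v, RunsWithin O
      (.add (r (.scratch d)) (r (.scratch d)) (r (.scratch (d + 1))) ;;
        .sub (r (.scratch (d + 2))) (r (.scratch (d + 2))) (r (.scratch (d + 3)))) u 2 v ∧
      Inv k v := by
    obtain ⟨hcount, hfactor, hone, hsum, hagree⟩ := hu
    refine ⟨_, (Exec.add u _ _ _).runsWithin.seq (Exec.sub _ _ _ _).runsWithin, ?_, ?_, ?_, ?_,
      (hagree.setReg le_rfl _).setReg (Nat.le_add_right d 2) _⟩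
    · simp [hcount, hone]
    · simp [hfactor]
    · simp [hone]
    · simp only [State.reg_setReg, EmbeddingLike.apply_eq_iff_eq, Slot.scratch.injEq,
        left_eq_add, OfNat.ofNat_ne_zero, if_false, if_true, hfactor]
      linarith
  obtain ⟨u, hrun, -, -, -, hu, hagree⟩ := RunsWithin.exists_loop (fun _ _ hI => hI.1) hround _ t
    ⟨rfl, rfl, h, rfl, .refl d t⟩
  exact ⟨u, hrun, by simpa using hu, hagree⟩

namespace Expr

variable (r O E s) in
/-- Started in a state that represents `E` and `s`, the compiled expression puts its value in the
slot `scratch d` in at most `T` steps, and only changes the slots `scratch k` with `d ≤ k`. -/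
def ComputedWithin (e : Expr Z I V) (T : ℕ) : Prop :=
  ∀ t d, Represents r E s t → ∃ u, RunsWithin O (e.compile r d) t T u ∧
    u.reg (r (.scratch d)) = e.eval E s ∧ AgreeBelow r d t u

variable {e f c : Expr Z I V} {T T' T'' : ℕ}

theorem ComputedWithin.mono (h : e.ComputedWithin r O E s T) (hT : T ≤ T') :
    e.ComputedWithin r O E s T' := fun t d ht =>
  let ⟨u, hrun, hu⟩ := h t d ht
  ⟨u, hrun.mono hT, hu⟩

theorem computedWithin_lit (c : ℕ) : (lit c).ComputedWithin r O E s 1 := fun t d _ =>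
  ⟨_, (Exec.const t _ c).runsWithin, by simp [eval], (AgreeBelow.refl d t).setReg le_rfl c⟩

theorem computedWithin_size (z : Z) : (size z).ComputedWithin r O E s 2 := fun t d ht =>
  ⟨_, runsWithin_copy (by simp), by simp [eval, ht.size], (AgreeBelow.refl d t).setReg le_rfl _⟩

theorem computedWithin_index (x : I) : (index x).ComputedWithin r O E s 2 := fun t d ht =>
  ⟨_, runsWithin_copy (by simp), by simp [eval, ht.index], (AgreeBelow.refl d t).setReg le_rfl _⟩

theorem computedWithin_var (x : V) : (var x).ComputedWithin r O E s 2 := fun t d ht =>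
  ⟨_, runsWithin_copy (by simp), by simp [eval, ht.var], (AgreeBelow.refl d t).setReg le_rfl _⟩

theorem ComputedWithin.input (he : e.ComputedWithin r O E s T) :
    (input e).ComputedWithin r O E s (T + 1) := fun t d ht => by
  obtain ⟨u, hrun, hu, hagree⟩ := he t d ht
  refine ⟨_, hrun.seq (Exec.load u _ 0 _).runsWithin, ?_, hagree.setReg le_rfl _⟩
  simp [eval, hu, hagree.mem, ht.input]

theorem ComputedWithin.cell (he : e.ComputedWithin r O E s T) :
    (cell e).ComputedWithin r O E s (T + 1) := fun t d ht => by
  obtain ⟨u, hrun, hu, hagree⟩ := he t d ht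
  refine ⟨_, hrun.seq (Exec.load u _ 1 _).runsWithin, ?_, hagree.setReg le_rfl _⟩
  simp [eval, hu, hagree.mem, ht.cell]

theorem ComputedWithin.add (he : e.ComputedWithin r O E s T) (hf : f.ComputedWithin r O E s T') :
    (add e f).ComputedWithin r O E s (T + (T' + 1)) := fun t d ht => by
  obtain ⟨u, hrun, hu, hagree⟩ := he t d ht
  obtain ⟨v, hrun', hv, hagree'⟩ := hf u (d + 1) (ht.of_agreeBelow hagree)
  refine ⟨_, hrun.seq (hrun'.seq (Exec.add v _ _ _).runsWithin), ?_,
    (hagree.trans hagree' d.le_succ).setReg le_rfl _⟩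
  simp [eval, hagree'.scratch d.lt_succ_self, hu, hv]

theorem ComputedWithin.sub (he : e.ComputedWithin r O E s T) (hf : f.ComputedWithin r O E s T') :
    (sub e f).ComputedWithin r O E s (T + (T' + 1)) := fun t d ht => by
  obtain ⟨u, hrun, hu, hagree⟩ := he t d ht
  obtain ⟨v, hrun', hv, hagree'⟩ := hf u (d + 1) (ht.of_agreeBelow hagree)
  refine ⟨_, hrun.seq (hrun'.seq (Exec.sub v _ _ _).runsWithin), ?_,
    (hagree.trans hagree' d.le_succ).setReg le_rfl _⟩
  simp [eval, hagree'.scratch d.lt_succ_self, hu, hv]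

theorem ComputedWithin.scale (he : e.ComputedWithin r O E s T) (z : Z) :
    (scale z e).ComputedWithin r O E s (T + (E.size z * 3 + 5)) := fun t d ht => by
  obtain ⟨u, hrun, hu, hagree⟩ := he t (d + 1) ht
  have hsize : u.reg (r (.size z)) = E.size z := (ht.of_agreeBelow hagree).size z
  let v := ((u.setReg (r (.scratch (d + 2))) (u.reg (r (.size z)))).setReg
    (r (.scratch (d + 3))) 1).setReg (r (.scratch d)) 0
  have hcount : v.reg (r (.scratch (d + 2))) = E.size z := by simp [v, hsize]
  obtain ⟨w, hloop, hw, hagree'⟩ :=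
    exists_runsWithin_accumulate (r := r) (O := O) (t := v) (d := d) (by simp [v])
  rw [hcount] at hloop hw
  refine ⟨w, (hrun.seq ((runsWithin_copy (by simp)).seq ((Exec.const _ _ 1).runsWithin.seq
    ((Exec.const _ _ 0).runsWithin.seq hloop)))).mono (by omega), ?_, ?_⟩
  · simp [hw, v, hu, eval]
  · refine AgreeBelow.trans ?_ hagree' le_rfl
    exact ((((AgreeBelow.refl d t).trans hagree d.le_succ).setReg (by omega) _).setReg
      (by omega) _).setReg le_rfl _

theorem ComputedWithin.cond (hc : c.ComputedWithin r O E s T) (he : e.ComputedWithin r O E s T')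
    (hf : f.ComputedWithin r O E s T'') :
    (cond c e f).ComputedWithin r O E s (T + (T' + T'' + 1)) := fun t d ht => by
  obtain ⟨u, hrun, hu, hagree⟩ := hc t d ht
  by_cases hc0 : c.eval E s = 0
  · obtain ⟨v, hrun', hv, hagree'⟩ := hf u d (ht.of_agreeBelow hagree)
    exact ⟨v, (hrun.seq (hrun'.ite_false (hu.trans hc0))).mono (by omega), by simp [eval, hc0, hv],
      hagree.trans hagree' le_rfl⟩
  · obtain ⟨v, hrun', hv, hagree'⟩ := he u d (ht.of_agreeBelow hagree)
    exact ⟨v, (hrun.seq (hrun'.ite_true (hu.trans_ne hc0))).mono (by omega),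
      by simp [eval, hc0, hv], hagree.trans hagree' le_rfl⟩

theorem computedWithin (e : Expr Z I V) (hN : ∀ z, E.size z ≤ N) :
    e.ComputedWithin r O E s (e.time.eval N) := by
  induction e with
  | lit c => simpa [time] using computedWithin_lit c
  | size z => simpa [time] using computedWithin_size z
  | index x => simpa [time] using computedWithin_index x
  | var x => simpa [time] using computedWithin_var x
  | input e he => simpa [time] using he.input
  | cell e he => simpa [time] using he.cell
  | add e f he hf => simpa [time, add_assoc] using he.add hf
  | sub e f he hf => simpa [time, add_assoc] using he.sub hf
  | scale z e he =>
    refine (he.scale z).mono ?_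
    simp only [time, Polynomial.eval_add, Polynomial.eval_mul, Polynomial.eval_X,
      Polynomial.eval_ofNat]
    linarith [hN z]
  | cond c e f hc he hf => simpa [time, add_assoc] using hc.cond he hf

end Expr

section CmdCompile

theorem Represents.setVar [DecidableEq V] (h : Represents r E s t) (x : V) (c : ℕ) :
    Represents r E (s.setVar x c) (t.setReg (r (.var x)) c) where
  size z := by simp [h.size]
  index y := by simp [h.index]
  var y := by simp [Store.setVar, Function.update_apply, h.var]
  input := h.input
  cell := h.cell
  outLength := by simp [Store.setVar, h.outLength]
  out := h.out

theorem Represents.bind [DecidableEq I] (h : Represents r E s t) (x : I) (c : ℕ) :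
    Represents r (E.bind x c) s (t.setReg (r (.index x)) c) where
  size z := by simp [Env.bind, h.size]
  index y := by simp [Env.bind, Function.update_apply, h.index]
  var y := by simp [h.var]
  input := h.input
  cell := h.cell
  outLength := by simp [h.outLength]
  out := h.out

theorem Env.bind_bind [DecidableEq I] (E : Env Z I) (x : I) (k l : ℕ) :
    (E.bind x k).bind x l = E.bind x l := by
  simp [Env.bind]

theorem Env.bind_index [DecidableEq I] (E : Env Z I) (x : I) : E.bind x (E.index x) = E := by
  simp [Env.bind]

theorem Represents.setCell (h : Represents r E s t) (i c : ℕ) :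
    Represents r E (s.setCell i c) (t.setMem 1 i c) where
  size := h.size
  index := h.index
  var := h.var
  input := by simp [h.input]
  cell := by simp [Store.setCell, h.cell]
  outLength := h.outLength
  out := by simpa [State.word, Store.setCell] using h.out

theorem Represents.clear (h : Represents r E s t) :
    Represents r E { s with out := [] } (t.setReg (r .outLength) 0) where
  size z := by simp [h.size]
  index y := by simp [h.index]
  var y := by simp [h.var]
  input := h.input
  cell := h.cell
  outLength := by simp
  out := rfl

theorem Represents.exists_runsWithin_append (h : Represents r E s t) (x d : ℕ) :
    ∃ u, RunsWithin O (append r x d) t 3 u ∧ Represents r E (s.emit [t.reg x]) u ∧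
      ∀ k < d, u.reg (r (.scratch k)) = t.reg (r (.scratch k)) := by
  refine ⟨_, (Exec.store t 2 _ x).runsWithin.seq
    ((Exec.const _ _ 1).runsWithin.seq (Exec.add _ _ _ _).runsWithin), ?_, ?_⟩
  · refine ⟨?_, ?_, ?_, ?_, ?_, ?_, ?_⟩
    · simp [h.size]
    · simp [h.index]
    · simp [Store.emit, h.var]
    · simp [h.input]
    · simp [Store.emit, h.cell]
    · simp [Store.emit, h.outLength]
    · let bank := Function.update (t.mem 2) s.out.length (t.reg x)
      have hbank : (List.range s.out.length).map bank = s.out := by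
        refine Eq.trans (List.map_congr_left fun i hi => ?_) h.out
        exact Function.update_of_ne (List.mem_range.mp hi).ne _ _
      simpa [State.word, Store.emit, List.range_succ, h.outLength] using hbank
  · grind [State.reg_setReg, State.reg_setMem, r.injective]

theorem wordSize_out_foldl_le {f : Store V → ℕ → Store V} {b : ℕ}
    (hf : ∀ s k, wordSize (f s k).out ≤ wordSize s.out + b) (s : Store V) (n : ℕ) :
    wordSize ((List.range n).foldl f s).out ≤ wordSize s.out + n * b := by
  induction n with
  | zero => simp
  | succ n ih =>
    rw [List.range_succ, List.foldl_append, List.foldl_cons, List.foldl_nil]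
    linarith [hf ((List.range n).foldl f s) n]

theorem Represents.exists_runsWithin_advance [DecidableEq I] {x : I}
    (h : Represents r (E.bind x k) s t) :
    ∃ u, RunsWithin O (advance r x d) t 3 u ∧ Represents r (E.bind x (k + 1)) s u ∧
      u.reg (r (.scratch (d + 1))) = t.reg (r (.scratch (d + 1))) - 1 ∧
      ∀ l < d + 1, u.reg (r (.scratch l)) = t.reg (r (.scratch l)) := by
  let u := (t.setReg (r (.scratch (d + 2))) 1).setReg (r (.scratch (d + 1)))
    (t.reg (r (.scratch (d + 1))) - 1)
  have hu : AgreeBelow r (d + 1) t u :=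
    ((AgreeBelow.refl _ t).setReg (d + 1).le_succ _).setReg le_rfl _
  have hindex : t.reg (r (.index x)) = k := by simp [h.index, Env.bind]
  refine ⟨u.setReg (r (.index x)) (k + 1), ?_, ?_, by simp [u], fun l hl => ?_⟩
  · have hrun : RunsWithin O (advance r x d) t 3 _ := (Exec.const t _ 1).runsWithin.seq
      ((Exec.sub _ _ _ _).runsWithin.seq (Exec.add _ _ _ _).runsWithin)
    simpa [u, hindex] using hrun
  · simpa only [Env.bind_bind] using (h.of_agreeBelow hu).bind x (k + 1)
  · simpa using hu.scratch hl

variable [DecidableEq I] [DecidableEq V]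

theorem Cmd.wordSize_out_eval_le (c : Cmd Z I V) (hN : ∀ z, E.size z ≤ N) (s : Store V) :
    wordSize (c.eval E s).out ≤ wordSize s.out + c.outBits.eval N := by
  induction c generalizing E s with
  | set x e => simp [eval, outBits, Store.setVar]
  | store i e => simp [eval, outBits, Store.setCell]
  | clear => simp [eval, wordSize]
  | emitSize z =>
    have : Nat.size (E.size z) ≤ N := (Nat.size_le.mpr Nat.lt_two_pow_self).trans (hN z)
    simp [eval, outBits, Store.emit, wordSize, this]
  | emitBit e =>
    by_cases he : e.eval E s = 0 <;> simp [eval, outBits, Store.emit, wordSize, he]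
  | query x => simp [eval, outBits, Store.setVar]
  | seq P Q ihP ihQ =>
    simp only [eval, outBits, Polynomial.eval_add]
    linarith [ihP hN s, ihQ hN (P.eval E s)]
  | loop x z P ih =>
    refine (wordSize_out_foldl_le (fun s k => ih (E := E.bind x k) hN s) s _).trans ?_
    simp only [outBits, Polynomial.eval_mul, Polynomial.eval_X]
    gcongr
    exact hN z

namespace Cmd

variable (r E s) in
/-- Started in a state that represents `E` and `s`, the compiled command takes at most `T` steps to
a state that represents `E` and the store after the command, and it keeps the slots `scratch k` with
`k < d`. -/
def ExecutedWithin (c : Cmd Z I V) (T : ℕ) : Prop :=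
  ∀ t d, Represents r E s t → ∃ u, RunsWithin E.oracle (c.compile r d) t T u ∧
    Represents r E (c.eval E s) u ∧ ∀ k < d, u.reg (r (.scratch k)) = t.reg (r (.scratch k))

variable {e i : Expr Z I V} {P Q : Cmd Z I V} {T T' : ℕ}

theorem ExecutedWithin.mono (h : P.ExecutedWithin r E s T) (hT : T ≤ T') :
    P.ExecutedWithin r E s T' := fun t d ht =>
  let ⟨u, hrun, hu⟩ := h t d ht
  ⟨u, hrun.mono hT, hu⟩

theorem executedWithin_set (x : V) (he : e.ComputedWithin r E.oracle E s T) :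
    (set x e).ExecutedWithin r E s (T + 2) := fun t d ht => by
  obtain ⟨u, hrun, hu, hagree⟩ := he t d ht
  refine ⟨_, hrun.seq (runsWithin_copy (by simp)), ?_, fun k hk => by simp [hagree.scratch hk]⟩
  exact hu ▸ (ht.of_agreeBelow hagree).setVar x _

theorem executedWithin_store (hi : i.ComputedWithin r E.oracle E s T)
    (he : e.ComputedWithin r E.oracle E s T') :
    (store i e).ExecutedWithin r E s (T + (T' + 1)) := fun t d ht => by
  obtain ⟨u, hrun, hu, hagree⟩ := hi t d ht
  obtain ⟨v, hrun', hv, hagree'⟩ := he u (d + 1) (ht.of_agreeBelow hagree)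
  have hagree := hagree.trans hagree' d.le_succ
  refine ⟨_, hrun.seq (hrun'.seq (Exec.store v 1 _ _).runsWithin), ?_,
    fun k hk => hagree.scratch hk⟩
  rw [hagree'.scratch d.lt_succ_self, hu, hv]
  exact (ht.of_agreeBelow hagree).setCell _ _

theorem executedWithin_clear : (clear : Cmd Z I V).ExecutedWithin r E s 1 := fun t _ ht =>
  ⟨_, (Exec.const t _ 0).runsWithin, ht.clear, by simp⟩

theorem executedWithin_emitSize (z : Z) : (emitSize z).ExecutedWithin r E s 3 := fun t d ht => by
  obtain ⟨u, hrun, hu, hkeep⟩ := ht.exists_runsWithin_append (r (.size z)) d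
  exact ⟨u, hrun, by simpa only [eval, ht.size] using hu, hkeep⟩

theorem executedWithin_emitBit (he : e.ComputedWithin r E.oracle E s T) :
    (emitBit e).ExecutedWithin r E s (T + 6) := fun t d ht => by
  obtain ⟨u, hrun, hu, hagree⟩ :=
    he.cond (Expr.computedWithin_lit 1) (Expr.computedWithin_lit 0) t d ht
  obtain ⟨v, hrun', hv, hkeep⟩ :=
    (ht.of_agreeBelow hagree).exists_runsWithin_append (r (.scratch d)) d
  refine ⟨v, hrun.seq hrun', ?_, fun k hk => by rw [hkeep k hk, hagree.scratch hk]⟩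
  simpa only [hu, Expr.eval, eval] using hv

theorem executedWithin_query (x : V) :
    (query x : Cmd Z I V).ExecutedWithin r E s (wordSize s.out + 1) := fun t d ht => by
  classical
  have hword : t.word 2 (t.reg (r .outLength)) = s.out := ht.outLength.symm ▸ ht.out
  have hrun : RunsWithin E.oracle ((query x).compile r d) t (1 + wordSize s.out)
      (t.setReg (r (.var x)) (if s.out ∈ E.oracle then 1 else 0)) := by
    split_ifs with hyes
    · exact hword ▸ (Exec.query_yes t _ 2 _ (hword.symm ▸ hyes)).runsWithin
    · exact hword ▸ (Exec.query_no t _ 2 _ (hword.symm ▸ hyes)).runsWithin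
  exact ⟨_, hrun.mono (add_comm _ _).le, ht.setVar x _, by simp⟩

theorem ExecutedWithin.seq (hP : P.ExecutedWithin r E s T)
    (hQ : Q.ExecutedWithin r E (P.eval E s) T') :
    (seq P Q).ExecutedWithin r E s (T + T') := fun t d ht => by
  obtain ⟨u, hrun, hu, hkeep⟩ := hP t d ht
  obtain ⟨v, hrun', hv, hkeep'⟩ := hQ u d hu
  exact ⟨v, hrun.seq hrun', hv, fun k hk => by rw [hkeep' k hk, hkeep k hk]⟩

theorem executedWithin_loop (x : I) (z : Z)
    (hP : ∀ k < E.size z, P.ExecutedWithin r (E.bind x k)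
      ((List.range k).foldl (fun s k => P.eval (E.bind x k) s) s) T) :
    (loop x z P).ExecutedWithin r E s (E.size z * (T + 4) + 8) := fun t d ht => by
  let store k := (List.range k).foldl (fun s k => P.eval (E.bind x k) s) s
  have hstore (k : ℕ) : store (k + 1) = P.eval (E.bind x k) (store k) := by
    simp only [store, List.range_succ, List.foldl_append, List.foldl_cons, List.foldl_nil]
  let n := E.size z
  let Inv (k : ℕ) (u : State) : Prop :=
    u.reg (r (.scratch (d + 1))) = k ∧ k ≤ n ∧ u.reg (r (.scratch d)) = E.index x ∧
      Represents r (E.bind x (n - k)) (store (n - k)) u ∧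
      ∀ l < d, u.reg (r (.scratch l)) = t.reg (r (.scratch l))
  have hround (k : ℕ) (u : State) (hu : Inv (k + 1) u) :
      ∃ v, RunsWithin E.oracle (P.compile r (d + 2) ;; advance r x d) u (T + 3) v ∧ Inv k v := by
    obtain ⟨hcount, hk, hsaved, hrep, hkeep⟩ := hu
    obtain ⟨v, hrun, hv, hvkeep⟩ := hP (n - (k + 1)) (by omega) u (d + 2) hrep
    obtain ⟨w, hrun', hw, hwcount, hwkeep⟩ := hv.exists_runsWithin_advance (d := d)
    rw [← hstore, show n - (k + 1) + 1 = n - k by omega] at hw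
    refine ⟨w, hrun.seq hrun', ?_, by omega, ?_, hw, fun l hl => ?_⟩
    · rw [hwcount, hvkeep _ (by omega), hcount, Nat.add_sub_cancel]
    · rw [hwkeep _ (by omega), hvkeep _ (by omega), hsaved]
    · rw [hwkeep l (by omega), hvkeep l (by omega), hkeep l hl]
  let t₁ := t.setReg (r (.scratch d)) (t.reg (r (.index x)))
  let t₂ := t₁.setReg (r (.scratch (d + 1))) (t₁.reg (r (.size z)))
  have ht₂ : AgreeBelow r d t t₂ := ((AgreeBelow.refl d t).setReg le_rfl _).setReg d.le_succ _
  have hstart : Inv n (t₂.setReg (r (.index x)) 0) :=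
    ⟨by simp [t₂, t₁, ht.size, n], le_rfl, by simp [t₂, t₁, ht.index],
      by simpa [store] using (ht.of_agreeBelow ht₂).bind x 0,
      fun l hl => by simpa using ht₂.scratch hl⟩
  obtain ⟨u, hloop, -, -, hsaved, hrep, hkeep⟩ :=
    RunsWithin.exists_loop (fun _ _ hI => hI.1) hround n _ hstart
  refine ⟨u.setReg (r (.index x)) (u.reg (r (.scratch d))),
    ((runsWithin_copy (by simp)).seq ((runsWithin_copy (by simp)).seq
      ((Exec.const _ _ 0).runsWithin.seq (hloop.seq (runsWithin_copy (by simp)))))).mono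
        (le_of_eq (by ring)), ?_, fun k hk => by simpa using hkeep k hk⟩
  have hrestored := hrep.bind x (E.index x)
  rw [Env.bind_bind, Env.bind_index] at hrestored
  exact hsaved ▸ hrestored

theorem executedWithin (c : Cmd Z I V) (hN : ∀ z, E.size z ≤ N) {L : Polynomial ℕ}
    (hL : wordSize s.out ≤ L.eval N) : c.ExecutedWithin r E s ((c.time L).eval N) := by
  induction c generalizing E s L with
  | set x e => simpa [time] using executedWithin_set x (e.computedWithin hN)
  | store i e =>
    simpa [time, add_assoc] using
      executedWithin_store (i.computedWithin hN) (e.computedWithin hN)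
  | clear => simpa [time] using executedWithin_clear
  | emitSize z => simpa [time] using executedWithin_emitSize z
  | emitBit e => simpa [time] using executedWithin_emitBit (e.computedWithin hN)
  | query x => exact (executedWithin_query x).mono (by simpa [time] using hL)
  | seq P Q hP hQ =>
    have hL' : wordSize (P.eval E s).out ≤ (L + P.outBits).eval N := by
      rw [Polynomial.eval_add]
      linarith [P.wordSize_out_eval_le hN s]
    simpa [time] using (hP hN hL).seq (hQ hN hL')
  | loop x z P hP =>
    let L' := L + .X * P.outBits
    have hround (k : ℕ) (hk : k < E.size z) : P.ExecutedWithin r (E.bind x k)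
        ((List.range k).foldl (fun s k => P.eval (E.bind x k) s) s) ((P.time L').eval N) := by
      refine hP (E := E.bind x k) (L := L') hN ((wordSize_out_foldl_le (b := P.outBits.eval N)
        (fun s k => P.wordSize_out_eval_le (E := E.bind x k) hN s) s k).trans ?_)
      simp only [L', Polynomial.eval_add, Polynomial.eval_mul, Polynomial.eval_X]
      gcongr
      exact hk.le.trans (hN z)
    refine (executedWithin_loop x z hround).mono ?_
    simp only [time, Polynomial.eval_add, Polynomial.eval_mul, Polynomial.eval_X,
      Polynomial.eval_ofNat]
    gcongr
    exact hN z

end Cmd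

end CmdCompile

end Compile

section Reduction

local notation:60 P:61 ";;" Q:60 => Prog.seq P Q

variable {Z I V : Type*}

/-- Assign a value to a size. -/
def Env.setSize [DecidableEq Z] (E : Env Z I) (z : Z) (k : ℕ) : Env Z I :=
  { E with size := Function.update E.size z k }

/-- Assign values to sizes, one after the other. -/
def Env.setSizes [DecidableEq Z] (s : Store V) (E : Env Z I) :
    List (Z × Expr Z I V) → Env Z I
  | [] => E
  | (z, e) :: l => (E.setSize z (e.eval E s)).setSizes s l

/-- The environment in which a program starts: all sizes and indices are zero. -/
def Env.init (w : Word) (O : Set Word) : Env Z I where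
  size _ := 0
  index _ := 0
  input i := w.getD i 0
  oracle := O

/-- The store with which a program starts: everything is zero or empty. -/
def Store.init : Store V where
  var _ := 0
  cell _ := 0
  out := []

/-- Compilation of a list of assignments to sizes. -/
def compileSizes (r : Slot Z I V ↪ ℕ) : List (Z × Expr Z I V) → Prog
  | [] => .skip
  | (z, e) :: l => e.compile r 0 ;; copy (r (.size z)) (r (.scratch 0)) ;; compileSizes r l

/-- A bound on the running time of compiled assignments to sizes, in terms of a bound on the
sizes. -/
noncomputable def sizesTime (l : List (Z × Expr Z I V)) : Polynomial ℕ :=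
  (l.map fun p => p.2.time + 2).sum + 1

variable {r : Slot Z I V ↪ ℕ} {O : Set Word} {E : Env Z I} {s : Store V} {t : State} {N : ℕ}

theorem Env.oracle_setSizes [DecidableEq Z] (s : Store V) (E : Env Z I)
    (l : List (Z × Expr Z I V)) : (E.setSizes s l).oracle = E.oracle := by
  induction l generalizing E with
  | nil => rfl
  | cons _ _ ih => exact ih _

theorem Represents.setSize [DecidableEq Z] (h : Represents r E s t) (z : Z) (k : ℕ) :
    Represents r (E.setSize z k) s (t.setReg (r (.size z)) k) where
  size y := by simp [Env.setSize, Function.update_apply, h.size]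
  index y := by simp [Env.setSize, h.index]
  var y := by simp [h.var]
  input := h.input
  cell := h.cell
  outLength := by simp [h.outLength]
  out := h.out

theorem Represents.exists_runsWithin_compileSizes [DecidableEq Z] (h : Represents r E s t)
    (l : List (Z × Expr Z I V)) (hN : ∀ l', l' <+: l → ∀ z, (E.setSizes s l').size z ≤ N) :
    ∃ u, RunsWithin O (compileSizes r l) t ((sizesTime l).eval N) u ∧
      Represents r (E.setSizes s l) s u := by
  induction l generalizing E t with
  | nil => exact ⟨t, (Exec.skip t).runsWithin.mono (by simp [sizesTime]), h⟩
  | cons p l ih =>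
    obtain ⟨z, e⟩ := p
    have hE : ∀ z, E.size z ≤ N := hN [] ⟨_, rfl⟩
    obtain ⟨u, hrun, hu, hagree⟩ := e.computedWithin (O := O) hE t 0 h
    obtain ⟨v, hrun', hv⟩ := ih ((h.of_agreeBelow hagree).setSize z (e.eval E s)) fun l' hl' =>
      hN ((z, e) :: l') (List.cons_prefix_cons.mpr ⟨rfl, hl'⟩)
    rw [← hu] at hrun'
    refine ⟨v, (hrun.seq ((runsWithin_copy (by simp)).seq hrun')).mono ?_, hv⟩
    simp only [sizesTime, List.map_cons, List.sum_cons, Polynomial.eval_add, Polynomial.eval_ofNat,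
      Polynomial.eval_one]
    omega

theorem represents_init (hr : ∀ x, r x ≠ 0) (w : Word) :
    Represents r (.init w O) .init (init w) where
  size _ := if_neg (hr _)
  index _ := if_neg (hr _)
  var _ := if_neg (hr _)
  input := rfl
  cell := rfl
  outLength := if_neg (hr _)
  out := rfl

theorem polyTimeTuringReducible_of_cmd [Countable Z] [Countable I] [Countable V] [DecidableEq Z]
    [DecidableEq I] [DecidableEq V] {A B : DecisionProblem} (sizes : List (Z × Expr Z I V))
    (c : Cmd Z I V) (answer : V) (b : Polynomial ℕ)
    (hsize : ∀ O, ∀ w ∈ A.instances, ∀ l, l <+: sizes → ∀ z,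
      ((Env.init w O).setSizes .init l).size z ≤ b.eval (wordSize w))
    (hanswer : ∀ O : Set Word, (∀ q ∈ B.instances, q ∈ O ↔ q ∈ B.yes) → ∀ w ∈ A.instances,
      ((c.eval ((Env.init w O).setSizes .init sizes) .init).var answer ≠ 0 ↔ w ∈ A.yes)) :
    PolyTimeTuringReducible A B := by
  obtain ⟨f⟩ := nonempty_embedding_nat (Slot Z I V)
  let r := f.trans ⟨Nat.succ, Nat.succ_injective⟩
  have hr (x : Slot Z I V) : r x ≠ 0 := (f x).succ_ne_zero
  refine ⟨compileSizes r sizes ;; c.compile r 0 ;; copy 0 (r (.var answer)),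
    (sizesTime sizes + (c.time 0 + 2)).comp b, fun O hO w hw => ?_⟩
  obtain ⟨t, hrun, ht⟩ :=
    (represents_init hr w).exists_runsWithin_compileSizes sizes (hsize O w hw)
  obtain ⟨u, hrun', hu, -⟩ :=
    c.executedWithin (hsize O w hw sizes List.prefix_rfl) (L := 0) (Nat.zero_le _) t 0 ht
  rw [Env.oracle_setSizes] at hrun'
  obtain ⟨k, hk, hexec⟩ := hrun.seq (hrun'.seq (runsWithin_copy (hr (.var answer))))
  refine ⟨k, _, hexec, by simpa [Polynomial.eval_comp] using hk, ?_⟩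
  simpa [hu.var] using hanswer O hO w hw

end Reduction

section Semantics

variable {Z I V : Type*} {E : Env Z I} {s : Store V}

namespace Expr

/-- An expression holds if its value is nonzero. -/
def Holds (E : Env Z I) (s : Store V) (e : Expr Z I V) : Prop := e.eval E s ≠ 0

/-- The negation of an expression. -/
def not (e : Expr Z I V) : Expr Z I V := .cond e (.lit 0) (.lit 1)

/-- The conjunction of two expressions. -/
def and (e f : Expr Z I V) : Expr Z I V := .cond e f (.lit 0)

/-- The disjunction of two expressions. -/
def or (e f : Expr Z I V) : Expr Z I V := .cond e (.lit 1) f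

/-- The comparison of two expressions by `≤`. -/
def le (e f : Expr Z I V) : Expr Z I V := not (.sub e f)

/-- The comparison of two expressions for equality. -/
def eq (e f : Expr Z I V) : Expr Z I V := and (le e f) (le f e)

variable (e f : Expr Z I V)

open Classical in
theorem eval_cond (c : Expr Z I V) :
    (cond c e f).eval E s = if c.Holds E s then e.eval E s else f.eval E s := by
  simp only [eval, Holds]
  congr

@[simp]
theorem holds_not : (not e).Holds E s ↔ ¬ e.Holds E s := by simp [not, Holds, eval]

@[simp]
theorem holds_and : (and e f).Holds E s ↔ e.Holds E s ∧ f.Holds E s := by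
  simp [and, Holds, eval]

@[simp]
theorem holds_or : (or e f).Holds E s ↔ e.Holds E s ∨ f.Holds E s := by
  by_cases he : e.eval E s = 0 <;> simp [or, Holds, eval, he]

@[simp]
theorem holds_le : (le e f).Holds E s ↔ e.eval E s ≤ f.eval E s := by
  simp [le, Holds, eval, not, Nat.sub_eq_zero_iff_le]

@[simp]
theorem holds_eq : (eq e f).Holds E s ↔ e.eval E s = f.eval E s := by
  rw [eq, holds_and, holds_le, holds_le, le_antisymm_iff]

end Expr

namespace Cmd

variable [DecidableEq I] [DecidableEq V] {P Q : Cmd Z I V} {x : I} {z : Z} {N : ℕ}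

theorem eval_loop (hN : E.size z = N) (s : Store V) :
    (loop x z P).eval E s =
      (List.finRange N).foldl (fun s (k : Fin N) => P.eval (E.bind x k) s) s := by
  rw [eval, hN, ← List.map_coe_finRange_eq_range, List.foldl_map]

theorem eval_loop_foldl {α : Type*} {R : α → Store V → Prop} {f : α → Fin N → α} {a : α}
    (hN : E.size z = N)
    (hP : ∀ (k : Fin N) a s, R a s → R (f a k) (P.eval (E.bind x k) s)) (h : R a s) :
    R ((List.finRange N).foldl f a) ((loop x z P).eval E s) := by
  rw [eval_loop hN]
  exact List.foldl_rel h fun k _ a s h => hP k a s h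

section Rel

variable {R : Store V → Store V → Prop} [Std.Refl R] [IsTrans (Store V) R]

theorem eval_loop_rel (hN : E.size z = N) (hP : ∀ (k : Fin N) s, R s (P.eval (E.bind x k) s))
    (s : Store V) : R s ((loop x z P).eval E s) := by
  rw [eval_loop hN]
  exact List.foldlRecOn _ _ (refl_of R s) fun t hst k _ => trans_of R hst (hP k t)

theorem exists_rel_eval_loop (hN : E.size z = N)
    (hP : ∀ (k : Fin N) s, R s (P.eval (E.bind x k) s)) (s : Store V) (k : Fin N) :
    ∃ t, R s t ∧ R (P.eval (E.bind x k) t) ((loop x z P).eval E s) := by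
  have hfoldl (l : List (Fin N)) (s : Store V) :
      R s (l.foldl (fun s (k : Fin N) => P.eval (E.bind x k) s) s) :=
    List.foldlRecOn _ _ (refl_of R s) fun t hst k _ => trans_of R hst (hP k t)
  obtain ⟨l, l', hl⟩ := List.append_of_mem (List.mem_finRange k)
  refine ⟨_, hfoldl l s, ?_⟩
  rw [eval_loop hN, hl, List.foldl_append, List.foldl_cons]
  exact hfoldl l' _

end Rel

/-- The only effect of a command is to append the word `w` to the word prepared for the oracle. -/
def Emits (E : Env Z I) (c : Cmd Z I V) (w : Word) : Prop := ∀ s, c.eval E s = s.emit w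

theorem emits_emitSize : Emits E (emitSize z : Cmd Z I V) [E.size z] := fun _ => rfl

open Classical in
theorem emits_emitBit {e : Expr Z I V} {p : Prop} (h : ∀ s, e.Holds E s ↔ p) :
    Emits E (emitBit e) [if p then 1 else 0] := fun s => by
  simp only [eval, ← h s, Expr.Holds]

theorem Emits.seq {w w' : Word} (hP : Emits E P w) (hQ : Emits E Q w') :
    Emits E (seq P Q) (w ++ w') := fun s => by
  rw [eval, hP, hQ, Store.emit, Store.emit, Store.emit, List.append_assoc]

theorem emits_loop {w : Fin N → Word} (hN : E.size z = N)
    (hP : ∀ k : Fin N, Emits (E.bind x k) P (w k)) :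
    Emits E (loop x z P) ((List.finRange N).flatMap w) := fun s => by
  rw [List.flatMap_eq_foldl]
  refine eval_loop_foldl (R := fun v t => t = s.emit v) hN (fun k v t ht => ?_) ?_
  · rw [ht, hP, Store.emit, Store.emit, Store.emit, List.append_assoc]
  · rw [Store.emit, List.append_nil]

end Cmd

end Semantics

section Program

/-- The sizes of the representability program: the order `m` of the group, the number `n` of
vertices, and, for the graphs submitted to the oracle, the number `n + 3` of copies of a vertex
and the number `n * (n + 3)` of vertices. -/
inductive Size
  | order | vertices | slots | total
  deriving DecidableEq, Countable

/-- The loop indices of the representability program: `round`, `x`, `y`, `z` run over the elements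
of the group, `i`, `j`, `u`, `v` over the vertices, `a` and `b` over the copies of a vertex. -/
inductive Index
  | round | x | y | z | i | j | u | a | v | b
  deriving DecidableEq, Countable

/-- The variables of the representability program. -/
inductive Var
  | pow | acc | reply | answer
  deriving DecidableEq, Countable

/-- The product of two elements of the group, read off its multiplication table. -/
def mulExpr (a b : Expr Size Index Var) : Expr Size Index Var :=
  .input (.add (.lit 2) (.add b (.scale .order a)))

/-- The adjacency of two vertices, read off the adjacency matrix. -/
def adjExpr (u v : Expr Size Index Var) : Expr Size Index Var :=
  .input (.add (.lit 2) (.add (.scale .order (.size .order)) (.add v (.scale .vertices u))))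

local notation:60 P:61 ";;" Q:60 => Cmd.seq P Q

variable {G : Type} [Group G] {m n : ℕ} (e : Fin m ≃ G) (X : SimpleGraph (Fin n)) (O : Set Word)
  (idx : Index → ℕ)

/-- The environment of the representability program. -/
noncomputable def env : Env Size Index where
  size
    | .order => m
    | .vertices => n
    | .slots => n + 3
    | .total => n * (n + 3)
  index := idx
  input i := (groupGraphWord e X).getD i 0
  oracle := O

variable {e X O idx} {s : Store Var}

theorem eval_mulExpr {a b : Expr Size Index Var} {g h : G}
    (ha : a.eval (env e X O idx) s = e.symm g) (hb : b.eval (env e X O idx) s = e.symm h) :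
    (mulExpr a b).eval (env e X O idx) s = e.symm (g * h) := by
  have := getD_groupGraphWord_table e X (e.symm g) (e.symm h)
  rwa [e.apply_symm_apply, e.apply_symm_apply, ← ha, ← hb] at this

theorem holds_adjExpr {a b : Expr Size Index Var} {u v : Fin n}
    (ha : a.eval (env e X O idx) s = u) (hb : b.eval (env e X O idx) s = v) :
    (adjExpr a b).Holds (env e X O idx) s ↔ X.Adj u v := by
  have h := getD_groupGraphWord_adj e X u v
  rw [← ha, ← hb] at h
  rw [Expr.Holds, show (adjExpr a b).eval (env e X O idx) s = _ from h]
  split_ifs with hadj <;> simp [hadj]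

section Closure

/-- Mark `z` if it is marked already, if it is the commutator of `x` and `y`, or if it is the
product of `x` and `y` and both are marked. -/
def closureStep : Cmd Size Index Var :=
  .store (.index .z) <| .or (.cell (.index .z)) <| .or
    (.eq (mulExpr (.index .z) (mulExpr (.index .y) (.index .x))) (mulExpr (.index .x) (.index .y)))
    (.and (.and (.cell (.index .x)) (.cell (.index .y)))
      (.eq (.index .z) (mulExpr (.index .x) (.index .y))))

/-- Mark all commutators and all products of two marked elements. -/
def closureRound : Cmd Size Index Var :=
  .loop .x .order (.loop .y .order (.loop .z .order closureStep))

/-- Mark the elements of the commutator subgroup. -/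
def closure : Cmd Size Index Var := .loop .round .order closureRound

/-- The elements of the group whose cells of the array are nonzero. -/
def marked (e : Fin m ≃ G) (s : Store Var) : Set G := {g | s.cell (e.symm g) ≠ 0}

omit [Group G] in
theorem mem_marked_setCell {k : Fin m} {c : ℕ} {g : G} :
    g ∈ marked e (s.setCell k c) ↔ g = e k ∧ c ≠ 0 ∨ g ≠ e k ∧ g ∈ marked e s := by
  have hk : (e.symm g : ℕ) = k ↔ g = e k := by rw [Fin.val_inj, e.symm_apply_eq]
  simp only [marked, Store.setCell, Set.mem_ofPred_eq, Function.update_apply, hk]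
  split_ifs with hg <;> simp [hg, ← hk]

open scoped commutatorElement in
theorem mem_marked_closureStep {x y z : Fin m} (hx : idx .x = x) (hy : idx .y = y)
    (hz : idx .z = z) {g : G} :
    g ∈ marked e (closureStep.eval (env e X O idx) s) ↔
      g ∈ marked e s ∨ g = e z ∧ (g = ⁅e x, e y⁆ ∨
        (e x ∈ marked e s ∧ e y ∈ marked e s) ∧ g = e x * e y) := by
  have hindex {w : Index} {k : Fin m} (hw : idx w = k) :
      (Expr.index w : Expr Size Index Var).eval (env e X O idx) s = e.symm (e k) := by
    rw [e.symm_apply_apply, ← hw]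
    rfl
  have hcell {w : Index} {k : Fin m} (hw : idx w = k) :
      (Expr.cell (.index w) : Expr Size Index Var).Holds (env e X O idx) s ↔ e k ∈ marked e s := by
    rw [Expr.Holds, Expr.eval, hindex hw]
    rfl
  have hmul := eval_mulExpr (hindex hx) (hindex hy)
  have hmul' := eval_mulExpr (hindex hz) (eval_mulExpr (hindex hy) (hindex hx))
  have hcomm : e z * (e y * e x) = e x * e y ↔ e z = ⁅e x, e y⁆ := by
    rw [commutatorElement_def, mul_assoc, ← mul_inv_rev, eq_mul_inv_iff_mul_eq]
  rw [closureStep, Cmd.eval, hindex hz, e.symm_apply_apply, mem_marked_setCell]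
  rw [← Expr.Holds, Expr.holds_or, Expr.holds_or, Expr.holds_and, Expr.holds_and, Expr.holds_eq,
    Expr.holds_eq, hcell hx, hcell hy, hcell hz, hmul, hmul', hindex hz, Fin.val_inj, Fin.val_inj,
    e.symm.apply_eq_iff_eq, e.symm.apply_eq_iff_eq, hcomm]
  grind

/-- The store `t` arises from `s` by marking further elements, which belong to the commutator
subgroup if the elements marked in `s` do. -/
def Extends (e : Fin m ≃ G) (s t : Store Var) : Prop :=
  marked e s ⊆ marked e t ∧
    (marked e s ⊆ (commutator G : Set G) → marked e t ⊆ (commutator G : Set G))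

instance : Std.Refl (Extends e) := ⟨fun _ => ⟨subset_rfl, id⟩⟩

instance : IsTrans (Store Var) (Extends e) :=
  ⟨fun _ _ _ hst htu => ⟨hst.1.trans htu.1, htu.2 ∘ hst.2⟩⟩

theorem extends_closureStep {x y z : Fin m} (hx : idx .x = x) (hy : idx .y = y)
    (hz : idx .z = z) (s : Store Var) : Extends e s (closureStep.eval (env e X O idx) s) := by
  refine ⟨fun g hg => (mem_marked_closureStep hx hy hz).mpr (.inl hg), fun hs g hg => ?_⟩
  obtain hg | ⟨-, rfl | ⟨⟨hx, hy⟩, rfl⟩⟩ := (mem_marked_closureStep hx hy hz).mp hg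
  · exact hs hg
  · exact Subgroup.commutator_mem_commutator (Subgroup.mem_top _) (Subgroup.mem_top _)
  · exact mul_mem (hs hx) (hs hy)

theorem extends_loop_closureStep {x y : Fin m} (hx : idx .x = x) (hy : idx .y = y)
    (s : Store Var) :
    Extends e s ((Cmd.loop .z .order closureStep).eval (env e X O idx) s) :=
  Cmd.eval_loop_rel (N := m) rfl (fun z =>
    extends_closureStep (idx := Function.update idx .z z) hx hy rfl) s

theorem extends_loop_loop_closureStep {x : Fin m} (hx : idx .x = x) (s : Store Var) :
    Extends e s ((Cmd.loop .y .order (.loop .z .order closureStep)).eval (env e X O idx) s) :=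
  Cmd.eval_loop_rel (N := m) rfl (fun y =>
    extends_loop_closureStep (idx := Function.update idx .y y) hx rfl) s

theorem extends_closureRound (s : Store Var) :
    Extends e s (closureRound.eval (env e X O idx) s) :=
  Cmd.eval_loop_rel (N := m) rfl (fun x =>
    extends_loop_loop_closureStep (idx := Function.update idx .x x) rfl) s

theorem exists_extends_closureRound (x y z : Fin m) (s : Store Var) :
    ∃ t idx', idx' .x = ↑x ∧ idx' .y = ↑y ∧ idx' .z = ↑z ∧ Extends e s t ∧
      Extends e (closureStep.eval (env e X O idx') t) (closureRound.eval (env e X O idx) s) := by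
  let idx₁ := Function.update idx .x ↑x
  let idx₂ := Function.update idx₁ .y ↑y
  let idx₃ := Function.update idx₂ .z ↑z
  obtain ⟨t, hst, ht⟩ := Cmd.exists_rel_eval_loop (R := Extends e) (E := env e X O idx) (N := m)
    (x := .x) (z := .order) rfl
    (fun x => extends_loop_loop_closureStep (idx := Function.update idx .x x) rfl) s x
  obtain ⟨u, htu, hu⟩ := Cmd.exists_rel_eval_loop (R := Extends e) (E := env e X O idx₁) (N := m)
    (x := .y) (z := .order) rfl
    (fun y => extends_loop_closureStep (x := x) (idx := Function.update idx₁ .y y) rfl rfl) t y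
  obtain ⟨v, huv, hv⟩ := Cmd.exists_rel_eval_loop (R := Extends e) (E := env e X O idx₂) (N := m)
    (x := .z) (z := .order) rfl
    (fun z => extends_closureStep (x := x) (y := y) (idx := Function.update idx₂ .z z) rfl rfl rfl)
    u z
  exact ⟨v, idx₃, rfl, rfl, rfl, trans_of (Extends e) hst (trans_of (Extends e) htu huv),
    trans_of (Extends e) hv (trans_of (Extends e) hu ht)⟩

open scoped commutatorElement in
theorem commutatorSet_subset_marked_closureRound (s : Store Var) :
    commutatorSet G ⊆ marked e (closureRound.eval (env e X O idx) s) := by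
  rintro g ⟨x, y, rfl⟩
  obtain ⟨t, idx', hx, hy, hz, -, ht⟩ := exists_extends_closureRound (e := e) (X := X) (O := O)
    (idx := idx) (e.symm x) (e.symm y) (e.symm ⁅x, y⁆) s
  exact ht.1 ((mem_marked_closureStep hx hy hz).mpr (by simp))

theorem mul_mem_marked_closureRound {x y : G} (hx : x ∈ marked e s) (hy : y ∈ marked e s) :
    x * y ∈ marked e (closureRound.eval (env e X O idx) s) := by
  obtain ⟨t, idx', hx', hy', hz', hst, ht⟩ := exists_extends_closureRound (e := e) (X := X)
    (O := O) (idx := idx) (e.symm x) (e.symm y) (e.symm (x * y)) s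
  exact ht.1 ((mem_marked_closureStep hx' hy' hz').mpr
    (by simp [hst.1 hx, hst.1 hy]))

theorem marked_closure (h : marked e s = ∅) :
    marked e (closure.eval (env e X O idx) s) = (commutator G : Set G) := by
  have : Finite G := .of_equiv _ e
  let R (k : ℕ) (t : Store Var) : Prop := marked e t ⊆ (commutator G : Set G) ∧
    (k ≤ (marked e t).ncard ∨ (commutator G : Set G) ⊆ marked e t)
  have hround (r : Fin m) (k : ℕ) (t : Store Var) (ht : R k t) :
      R (k + 1) (closureRound.eval ((env e X O idx).bind .round r) t) := by
    have hext := extends_closureRound (e := e) (X := X) (O := O)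
      (idx := Function.update idx .round r) t
    refine ⟨hext.2 ht.1, ?_⟩
    obtain heq | hlt := hext.1.eq_or_ssubset
    · refine .inr (commutator_subset_of_mul_mem
        (commutatorSet_subset_marked_closureRound t) fun x hx y hy => ?_)
      exact mul_mem_marked_closureRound (heq.symm ▸ hx) (heq.symm ▸ hy)
    · exact ht.2.imp (fun hk => hk.trans_lt (Set.ncard_lt_ncard hlt)) (·.trans hext.1)
  obtain ⟨hsub, hcard | hsup⟩ := Cmd.eval_loop_foldl (x := Index.round) (z := Size.order)
    (E := env e X O idx) rfl hround (show R 0 s by simp [R, h])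
  · have huniv : marked e (closure.eval (env e X O idx) s) = Set.univ := by
      rw [Set.eq_univ_iff_ncard]
      refine (Set.ncard_le_card _).antisymm (hcard.trans' ?_)
      simp [List.foldl_const, Nat.card_congr e.symm, env]
    exact hsub.antisymm (huniv ▸ Set.subset_univ _)
  · exact hsub.antisymm hsup

end Closure

section MarkedGraph

/-- The mark of the vertex `u` in `markedGraph X i j`. -/
def markExpr (w : Index) : Expr Size Index Var :=
  .cond (.eq (.index .u) (.index w)) (.add (.index .i) (.lit 3))
    (.cond (.sub (.index .i) (.index .u)) (.add (.index .u) (.lit 3)) (.lit 2))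

/-- The adjacency of the vertices `(u, a)` and `(v, b)` of `markedGraph X i j`, with `j` the index
`w`. -/
def markedAdjExpr (w : Index) : Expr Size Index Var :=
  .or (.and (.not (.index .a)) (.and (.not (.index .b)) (adjExpr (.index .u) (.index .v)))) <|
    .and (.eq (.index .u) (.index .v)) <| .or
      (.and (.not (.index .a)) (.and (.index .b) (.le (.index .b) (markExpr w))))
      (.and (.not (.index .b)) (.and (.index .a) (.le (.index .a) (markExpr w))))

/-- Append the adjacency matrix of `markedGraph X i j`, with `j` the index `w`, to the word prepared
for the oracle. -/
def emitMarkedGraph (w : Index) : Cmd Size Index Var :=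
  .loop .u .vertices (.loop .a .slots (.loop .v .vertices (.loop .b .slots
    (.emitBit (markedAdjExpr w)))))

/-- Prepare the query whether `markedGraph X i i` and `markedGraph X i j` are isomorphic. -/
def emitMarkedGraphs : Cmd Size Index Var :=
  .emitSize .total ;; .emitSize .total ;; emitMarkedGraph .i ;; emitMarkedGraph .j

/-- Ask the oracle whether some automorphism that fixes the vertices before `i` maps `i` to `j`. -/
def queryOrbit : Cmd Size Index Var := emitMarkedGraphs ;; .query .reply ;; .clear

theorem eval_markExpr {w : Index} {i j u : Fin n} (hi : idx .i = i) (hj : idx w = j)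
    (hu : idx .u = u) : (markExpr w).eval (env e X O idx) s = mark i j u := by
  classical
  have hlt : (Expr.sub (.index .i) (.index .u) : Expr Size Index Var).Holds (env e X O idx) s ↔
      u < i := by
    simp [Expr.Holds, Expr.eval, env, hi, hu, Nat.sub_eq_zero_iff_le]
  rw [markExpr, Expr.eval_cond, Expr.eval_cond, Expr.holds_eq, hlt]
  simp only [Expr.eval, env, hi, hj, hu, mark, Fin.val_inj]
  congr

theorem holds_markedAdjExpr {w : Index} {i j u v : Fin n} {a b : Fin (n + 2 + 1)}
    (hi : idx .i = i) (hj : idx w = j) (hu : idx .u = u) (hv : idx .v = v) (ha : idx .a = a)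
    (hb : idx .b = b) :
    (markedAdjExpr w).Holds (env e X O idx) s ↔
      (withPendants X (mark i j) (n + 2)).Adj (u, a) (v, b) := by
  have hindex {t : Index} {k : ℕ} (ht : idx t = k) :
      (Expr.index t : Expr Size Index Var).eval (env e X O idx) s = k := ht
  have hslot {t : Index} {c : Fin (n + 2 + 1)} (ht : idx t = c) :
      (Expr.index t : Expr Size Index Var).Holds (env e X O idx) s ↔ c ≠ 0 := by
    rw [Expr.Holds, hindex ht, Fin.val_ne_zero_iff]
  rw [markedAdjExpr]
  simp only [Expr.holds_or, Expr.holds_and, Expr.holds_not, Expr.holds_eq, Expr.holds_le,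
    holds_adjExpr (hindex hu) (hindex hv), hindex hu, hindex hv, hindex ha, hindex hb, hslot ha,
    hslot hb, eval_markExpr hi hj hu, Fin.val_inj, not_not, withPendants]

theorem emits_emitMarkedGraph {w : Index} {i j : Fin n} (hw : w ∉ [Index.u, .a, .v, .b])
    (hi : idx .i = i) (hj : idx w = j) :
    (emitMarkedGraph w).Emits (env e X O idx) (adjWord (markedGraph X i j)) := by
  simp only [List.mem_cons, List.not_mem_nil, or_false, not_or] at hw
  rw [markedGraph, adjWord_comap_finProdFinEquiv]
  simp only [List.map_eq_flatMap]
  refine Cmd.emits_loop rfl fun u => Cmd.emits_loop rfl fun a => Cmd.emits_loop rfl fun v =>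
    Cmd.emits_loop rfl fun b => ?_
  let idx' := Function.update (Function.update (Function.update (Function.update idx .u ↑u) .a ↑a)
    .v ↑v) .b ↑b
  have hi' : idx' .i = i := hi
  have hj' : idx' w = j := by simp [idx', hw, hj]
  exact Cmd.emits_emitBit (E := env e X O idx') fun s =>
    holds_markedAdjExpr (u := u) (v := v) (a := a) (b := b) hi' hj' rfl rfl rfl rfl

theorem emits_emitMarkedGraphs {i j : Fin n} (hi : idx .i = i) (hj : idx .j = j) :
    emitMarkedGraphs.Emits (env e X O idx)
      (graphPairWord (markedGraph X i i) (markedGraph X i j)) :=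
  Cmd.emits_emitSize.seq <| Cmd.emits_emitSize.seq <|
    (emits_emitMarkedGraph (by simp) hi hi).seq (emits_emitMarkedGraph (by simp) hi hj)

open Classical in
theorem eval_queryOrbit (hO : ∀ q ∈ graphIsomorphism.instances, q ∈ O ↔ q ∈ graphIsomorphism.yes)
    {i j : Fin n} (hi : idx .i = i) (hj : idx .j = j) (hs : s.out = []) :
    queryOrbit.eval (env e X O idx) s = s.setVar .reply
      (if j ∈ MulAction.orbit (fixingSubgroup (X ≃g X) (Set.Iio i)) i then 1 else 0) := by
  have hword : graphPairWord (markedGraph X i i) (markedGraph X i j) ∈ O ↔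
      j ∈ MulAction.orbit (fixingSubgroup (X ≃g X) (Set.Iio i)) i := by
    rw [hO _ ⟨_, _, _, _, rfl⟩, graphPairWord_mem_yes_iff, nonempty_iso_markedGraph_iff]
  rw [queryOrbit, Cmd.eval, emits_emitMarkedGraphs hi hj]
  simp [Cmd.eval, Store.setVar, Store.emit, hs, env, hword]

end MarkedGraph

section Search

/-- Multiply `acc` by `pow` if `j ≠ i` and some automorphism that fixes the vertices before `i` maps
`i` to `j`. -/
def orbitStep : Cmd Size Index Var :=
  queryOrbit ;; .set .acc (.cond (.and (.var .reply) (.not (.eq (.index .i) (.index .j))))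
    (mulExpr (.var .acc) (.var .pow)) (.var .acc))

/-- Multiply `acc` by `pow` for each point `j ≠ i` of the orbit of `i` under the automorphisms that
fix the vertices before `i`. -/
def orbitPower : Cmd Size Index Var := .loop .j .vertices orbitStep

/-- Raise `pow` to the power of the order of the automorphism group of the graph. -/
def autPower : Cmd Size Index Var :=
  .loop .i .vertices (.set .acc (.var .pow) ;; orbitPower ;; .set .pow (.var .acc))

/-- Set `answer` if `x` is an unmarked element of the group and its power by the order of the
automorphism group is marked. -/
def searchStep : Cmd Size Index Var :=
  .set .pow (.index .x) ;; autPower ;;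
    .set .answer (.or (.var .answer) (.and (.not (.cell (.index .x))) (.cell (.var .pow))))

/-- Search for an unmarked element whose power by the order of the automorphism group is marked. -/
def search : Cmd Size Index Var := .loop .x .order searchStep

/-- The array holds `c`, the variable `answer` holds `r`, and the word prepared for the oracle is
empty. -/
def Keeps (c : ℕ → ℕ) (r : ℕ) (s : Store Var) : Prop :=
  s.cell = c ∧ s.var .answer = r ∧ s.out = []

variable {c : ℕ → ℕ} {r : ℕ} {g : G}

/-- The contents of a store during the computation of a power: besides what is kept, the variables
`pow` and `acc` hold `g` and `h`. -/
def Powers (e : Fin m ≃ G) (c : ℕ → ℕ) (r : ℕ) (g h : G) (s : Store Var) : Prop :=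
  Keeps c r s ∧ s.var .pow = e.symm g ∧ s.var .acc = e.symm h

section Oracle

variable (hO : ∀ q ∈ graphIsomorphism.instances, q ∈ O ↔ q ∈ graphIsomorphism.yes)
include hO

open Classical in
theorem powers_orbitStep {i j : Fin n} (hi : idx .i = i) (hj : idx .j = j) {h : G}
    (hs : Powers e c r g h s) :
    Powers e c r g
      (if j ∈ MulAction.orbit (fixingSubgroup (X ≃g X) (Set.Iio i)) i ∧ j ≠ i then h * g else h)
      (orbitStep.eval (env e X O idx) s) := by
  have hquery := eval_queryOrbit (e := e) (X := X) hO hi hj hs.1.2.2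
  have hmove : (Expr.and (.var .reply) (.not (.eq (.index .i) (.index .j))) :
      Expr Size Index Var).Holds (env e X O idx) (queryOrbit.eval (env e X O idx) s) ↔
      j ∈ MulAction.orbit (fixingSubgroup (X ≃g X) (Set.Iio i)) i ∧ j ≠ i := by
    rw [Expr.holds_and, Expr.holds_not, Expr.holds_eq, hquery]
    simp [Expr.Holds, Expr.eval, Store.setVar, env, hi, hj, Fin.val_inj, eq_comm]
  obtain ⟨hkeeps, hpow, hacc⟩ : Powers e c r g h (queryOrbit.eval (env e X O idx) s) := by
    rw [hquery]
    exact hs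
  rw [orbitStep, Cmd.eval, Cmd.eval, Expr.eval_cond]
  simp only [hmove]
  refine ⟨hkeeps, hpow, ?_⟩
  simp only [Store.setVar, Function.update_self]
  split_ifs
  · exact eval_mulExpr hacc hpow
  · exact hacc

theorem powers_orbitPower {i : Fin n} (hi : idx .i = i) (hs : Powers e c r g g s) :
    Powers e c r g (g ^ orbitLength X i) (orbitPower.eval (env e X O idx) s) := by
  classical
  have h := Cmd.eval_loop_foldl (R := Powers e c r g) (N := n) (E := env e X O idx)
    (x := .j) (z := .vertices) rfl
    (fun j h t => powers_orbitStep (h := h) (idx := Function.update idx .j j) hO hi rfl) hs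
  rw [← countP_orbit_add_one, pow_succ', ← foldl_ite_mul]
  simp only [decide_eq_true_eq]
  exact h

theorem keeps_autPower (hs : Keeps c r s) (hpow : s.var .pow = e.symm g) :
    Keeps c r (autPower.eval (env e X O idx) s) ∧
      (autPower.eval (env e X O idx) s).var .pow = e.symm (g ^ Nat.card (X ≃g X)) := by
  let R (g : G) (s : Store Var) : Prop := Keeps c r s ∧ s.var .pow = e.symm g
  have hstep (i : Fin n) (g : G) (s : Store Var) (hs : R g s) : R (g ^ orbitLength X i)
      ((Cmd.seq (.set .acc (.var .pow)) (orbitPower ;; .set .pow (.var .acc))).eval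
        ((env e X O idx).bind .i i) s) := by
    have hacc : Powers e c r g g (s.setVar .acc (s.var .pow)) := ⟨hs.1, hs.2, hs.2⟩
    obtain ⟨hkeeps, -, hacc⟩ :=
      powers_orbitPower (idx := Function.update idx .i i) hO rfl hacc
    exact ⟨hkeeps, hacc⟩
  have hpower := Cmd.eval_loop_foldl (R := R) (N := n) (E := env e X O idx) (x := .i)
    (z := .vertices) rfl hstep ⟨hs, hpow⟩
  rwa [foldl_pow, ← Fin.prod_univ_def, prod_orbitLength] at hpower

theorem searchStep_spec {x : Fin m} (hx : idx .x = x) (hs : s.out = []) :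
    let t := searchStep.eval (env e X O idx) s
    t.cell = s.cell ∧ t.out = [] ∧ (t.var .answer ≠ 0 ↔ s.var .answer ≠ 0 ∨
      e x ∉ marked e s ∧ e x ^ Nat.card (X ≃g X) ∈ marked e s) := by
  have hindex : (Expr.index .x : Expr Size Index Var).eval (env e X O idx) s =
      e.symm (e x) := by
    rw [Expr.eval, e.symm_apply_apply, ← hx, env]
  obtain ⟨⟨hcell, hanswer, hout⟩, hpow⟩ := keeps_autPower (X := X) (e := e) (idx := idx)
    (s := s.setVar .pow (e.symm (e x))) (g := e x) hO ⟨rfl, rfl, hs⟩ (by simp [Store.setVar])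
  rw [searchStep, Cmd.eval, Cmd.eval, hindex]
  refine ⟨hcell, hout, ?_⟩
  change (Expr.or _ _).Holds _ _ ↔ _
  rw [Expr.holds_or, Expr.holds_and, Expr.holds_not]
  refine or_congr ?_ (and_congr (not_congr ?_) ?_)
  · rw [Expr.Holds, Expr.eval, hanswer]
    rfl
  · rw [Expr.Holds, Expr.eval, hcell, marked, Set.mem_ofPred_eq, e.symm_apply_apply, ← hx]
    rfl
  · rw [Expr.Holds, Expr.eval, Expr.eval, hpow, hcell]
    rfl

theorem answer_search_ne_zero_iff (hs : s.out = []) :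
    (search.eval (env e X O idx) s).var .answer ≠ 0 ↔
      s.var .answer ≠ 0 ∨ ∃ g ∉ marked e s, g ^ Nat.card (X ≃g X) ∈ marked e s := by
  let found (x : Fin m) : Prop := e x ∉ marked e s ∧ e x ^ Nat.card (X ≃g X) ∈ marked e s
  let R (p : Prop) (t : Store Var) : Prop :=
    t.cell = s.cell ∧ t.out = [] ∧ (t.var .answer ≠ 0 ↔ p)
  have hstep (x : Fin m) (p : Prop) (t : Store Var) (ht : R p t) :
      R (p ∨ found x) (searchStep.eval ((env e X O idx).bind .x x) t) := by
    obtain ⟨hcell, hout, hanswer⟩ := ht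
    obtain ⟨hcell', hout', hanswer'⟩ :=
      searchStep_spec (e := e) (X := X) (idx := Function.update idx .x x) hO rfl hout
    have hmarked : marked e t = marked e s := by rw [marked, hcell, marked]
    rw [hanswer, hmarked] at hanswer'
    exact ⟨hcell'.trans hcell, hout', hanswer'⟩
  obtain ⟨-, -, hanswer⟩ := Cmd.eval_loop_foldl (R := R) (N := m) (E := env e X O idx) (x := .x)
    (z := .order) rfl hstep ⟨rfl, hs, Iff.rfl⟩
  rw [search, hanswer, foldl_or]
  simp [found, e.surjective.exists]

end Oracle

end Search

/-- Decide whether the group is representable on the graph, and store the result in `answer`. -/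
def representability : Cmd Size Index Var :=
  closure ;; .set .answer (.lit 0) ;; .clear ;; search

theorem answer_representability_ne_zero_iff [Group.IsSolvable G]
    (hO : ∀ q ∈ graphIsomorphism.instances, q ∈ O ↔ q ∈ graphIsomorphism.yes) :
    (representability.eval (env e X O idx) .init).var .answer ≠ 0 ↔ Representable G X := by
  have : Finite G := .of_equiv _ e
  have hmarked : marked e (closure.eval (env e X O idx) .init) = (commutator G : Set G) :=
    marked_closure (by simp [marked, Store.init])
  have : Finite (X ≃g X) := DFunLike.finite _
  let t : Store Var :=
    { (closure.eval (env e X O idx) .init).setVar .answer 0 with out := [] }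
  change (search.eval (env e X O idx) t).var .answer ≠ 0 ↔ _
  have ht : marked e t = (commutator G : Set G) := hmarked
  rw [answer_search_ne_zero_iff hO rfl, ht, representable_iff_exists_prime,
    ← exists_notMem_pow_mem_commutator_iff]
  simp [t, Store.setVar]

/-- The assignments that compute the sizes of the representability program from its input. -/
def sizeAssignments : List (Size × Expr Size Index Var) :=
  [(.order, .input (.lit 0)), (.vertices, .input (.lit 1)),
    (.slots, .add (.size .vertices) (.lit 3)), (.total, .scale .vertices (.size .slots))]

theorem setSizes_sizeAssignments :
    (Env.init (groupGraphWord e X) O).setSizes .init sizeAssignments = env e X O fun _ => 0 := by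
  refine congrArg (Env.mk · _ _ _) (funext fun z => ?_)
  cases z <;> rfl

theorem size_setSizes_le {l : List (Size × Expr Size Index Var)} (hl : l <+: sizeAssignments)
    (z : Size) : ((Env.init (groupGraphWord e X) O).setSizes .init l).size z ≤
      (wordSize (groupGraphWord e X) + 3) ^ 2 := by
  have hm := order_le_wordSize_groupGraphWord e X
  have hn := vertices_le_wordSize_groupGraphWord e X
  have hsize : ((Env.init (groupGraphWord e X) O).setSizes .init l).size z ≤
      (env e X O fun _ => 0).size z := by
    simp only [sizeAssignments, List.prefix_cons_iff, List.prefix_nil] at hl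
    obtain rfl | ⟨_, rfl, rfl | ⟨_, rfl, rfl | ⟨_, rfl, rfl | ⟨_, rfl, rfl⟩⟩⟩⟩ := hl <;>
      cases z <;> first | exact Nat.zero_le _ | exact le_rfl
  refine hsize.trans ?_
  cases z <;> simp only [env] <;> nlinarith

theorem solvableRepresentability_reducible :
    PolyTimeTuringReducible solvableRepresentability graphIsomorphism := by
  refine polyTimeTuringReducible_of_cmd sizeAssignments representability .answer
    ((.X + 3) ^ 2) (fun O w hw l hl z => ?_) (fun O hO w hw => ?_)
  · obtain ⟨G, _, m, n, e, X, -, rfl⟩ := hw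
    simpa using size_setSizes_le hl z
  · obtain ⟨G, _, m, n, e, X, _, rfl⟩ := hw
    rw [setSizes_sizeAssignments, answer_representability_ne_zero_iff hO,
      groupGraphWord_mem_yes_iff]

end Program

end OracleRAM

theorem mainTheorem2_general :
    PolyTimeTuringReducible solvableRepresentability graphIsomorphism ∧
    ∀ (G : Type*) [Group G] [Group.IsSolvable G] [Finite (G ⧸ commutator G)] (V : Type*)
      (X : SimpleGraph V) [Finite (X ≃g X)],
      Representable G X ↔
        ∃ p : ℕ, p.Prime ∧ p ∣ Nat.card (G ⧸ commutator G) ∧ p ∣ Nat.card (X ≃g X) :=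
  ⟨OracleRAM.solvableRepresentability_reducible, fun _ _ _ _ _ _ _ =>
    representable_iff_exists_prime⟩

theorem mainTheorem2 :
    PolyTimeTuringReducible solvableRepresentability graphIsomorphism ∧
    ∀ (G : Type*) [Group G] [Finite G] [Group.IsSolvable G] (V : Type*) [Finite V] (X : SimpleGraph V),
      Representable G X ↔
        ∃ p : ℕ, p.Prime ∧ p ∣ Nat.card (G ⧸ commutator G) ∧ p ∣ Nat.card (X ≃g X) := by
  exact mainTheorem2_general.imp_right fun h G _ _ _ V _ X =>
    have : Finite (X ≃g X) := DFunLike.finite _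
    h G V X
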